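/- All graphs are finite and simple. A set $S$ of $j$ vertices of a graph $G$ is a *1-sparse $j$-set* if each vertex of $S$ has at most one neighbour in $S$; a set of $i$ vertices is a *1-dense $i$-set* of $G$ if it is a 1-sparse $i$-set of the complement of $G$. A graph is *perfect* if the chromatic number of each of its induced subgraphs equals the size of a largest clique of that subgraph. Let $R_1^{\mathcal{PG}}(4,8)$ be the smallest $n$ such that every perfect graph on $n$ vertices has a 1-dense 4-set or a 1-sparse 8-set. An *extremal graph* for $R_1^{\mathcal{PG}}(4,8)=15$ is a perfect graph on $14$ vertices with no 1-dense 4-set and no 1-sparse 8-set. **Theorem.** $R_1^{\mathcal{PG}}(4,8)=15$, and up to isomorphism there are exactly three extremal graphs for $R_1^{\mathcal{PG}}(4,8)=15$. They are the following pairwise non-isomorphic graphs on the vertex set $\{0,1,\dots,13\}$: - $G_1$, the Heawood graph: its edges are $\{a,a+1\}$ for all $a$ and $\{a,a+5\}$ for all even $a$, with addition modulo $14$; - $G_2$, with $23$ edges: the $18$ edges of the six triangles $\{0,1,2\}$, $\{2,3,4\}$, $\{4,5,6\}$, $\{7,8,9\}$, $\{9,10,11\}$, $\{11,12,13\}$,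 and the five edges $\{0,13\}$, $\{1,8\}$, $\{3,10\}$, $\{5,12\}$, $\{6,7\}$; - $G_3$, which is $G_2$ without the edge $\{3,10\}$. -/

import Mathlib

/-- `S` is a `k`-sparse set of `G`: each vertex of `S` has at most `k` neighbours in `S`. -/
def IsSparseSet {V : Type*} (G : SimpleGraph V) (k : ℕ) (S : Finset V) : Prop :=
  ∀ v ∈ S, {w : V | w ∈ S ∧ G.Adj v w}.ncard ≤ k

/-- `S` is a `k`-dense set of `G`: it is `k`-sparse in the complement of `G`. -/
def IsDenseSet {V : Type*} (G : SimpleGraph V) (k : ℕ) (S : Finset V) : Prop :=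
  IsSparseSet Gᶜ k S

def HasSparseSet {V : Type*} (G : SimpleGraph V) (k j : ℕ) : Prop :=
  ∃ S : Finset V, S.card = j ∧ IsSparseSet G k S

def HasDenseSet {V : Type*} (G : SimpleGraph V) (k i : ℕ) : Prop :=
  ∃ S : Finset V, S.card = i ∧ IsDenseSet G k S

/-- A finite graph is perfect if the chromatic number of each of its induced subgraphs equals
the size of a largest clique of that subgraph. -/
def IsPerfectGraph {V : Type*} [Finite V] (G : SimpleGraph V) : Prop :=
  ∀ s : Set V, (G.induce s).chromaticNumber = ((G.induce s).cliqueNum : ℕ∞)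

/-- `R` is the `k`-defective Ramsey number of the class of perfect graphs for `(i, j)`: the
smallest `n` such that every perfect graph on `n` vertices has a `k`-dense `i`-set or a
`k`-sparse `j`-set. -/
def IsPerfectDefectiveRamsey (k i j R : ℕ) : Prop :=
  IsLeast {n : ℕ | ∀ G : SimpleGraph (Fin n), IsPerfectGraph G →
    HasDenseSet G k i ∨ HasSparseSet G k j} R

/-- `G` is extremal for "the `k`-defective Ramsey number of perfect graphs for `(i, j)` is `n`":
it is a perfect graph of order `n - 1` with neither a `k`-dense `i`-set nor a `k`-sparse
`j`-set. -/
structure IsPerfectExtremal {V : Type*} [Finite V] (k i j n : ℕ) (G : SimpleGraph V) : Prop where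
  order : Nat.card V + 1 = n
  perfect : IsPerfectGraph G
  noDense : ¬ HasDenseSet G k i
  noSparse : ¬ HasSparseSet G k j

/-- The Heawood graph, in its standard description by the LCF code `[5, -5]^7`: a Hamiltonian
cycle `0, 1, …, 13` together with a chord from each even `a` to `a + 5` (modulo 14). -/
def heawoodGraph : SimpleGraph (Fin 14) :=
  SimpleGraph.fromRel fun a b => b = a + 1 ∨ (a.val % 2 = 0 ∧ b = a + 5)

/-- Two chains of three triangles, `{0, 1, 2}`, `{2, 3, 4}`, `{4, 5, 6}` and `{7, 8, 9}`,
`{9, 10, 11}`, `{11, 12, 13}`, together with five edges between the chains. -/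
def extremalGraph₂ : SimpleGraph (Fin 14) :=
  SimpleGraph.fromRel fun a b => (a, b) ∈
    ([(0, 1), (0, 2), (1, 2), (2, 3), (2, 4), (3, 4), (4, 5), (4, 6), (5, 6),
      (7, 8), (7, 9), (8, 9), (9, 10), (9, 11), (10, 11), (11, 12), (11, 13), (12, 13),
      (0, 13), (1, 8), (3, 10), (5, 12), (6, 7)] : List (Fin 14 × Fin 14))

/-- The graph `extremalGraph₂` without the edge joining `3` and `10`. -/
def extremalGraph₃ : SimpleGraph (Fin 14) :=
  extremalGraph₂.deleteEdges {s(3, 10)}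

/-!
A `1`-dense set of four vertices is the same as a cycle of length four, and a cycle of length five
in a graph without cycles of length four is induced, so that a perfect graph does not contain it
(`noFourFiveCycle_of_isPerfectGraph`). The graphs in question therefore have no cycles of length
four or five, and their `1`-sparse sets, called sparse below, are the sets inducing a graph of
maximum degree at most one. Among the graphs without cycles of length four and five on fourteen
vertices, exactly four have no sparse set of eight vertices: the three graphs of the theorem and a
ring of seven triangles. The latter contains an induced cycle of length seven and so is not perfect
(`nonempty_iso_of_mem_leafCodes`).

That there are no others is the result of an exhaustive search, evaluated by the kernel
(`exists_code`). The vertices of a graph are found in a lexicographic breadth-first order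
(`LexOrder`): the next vertex is one whose set of neighbours among the vertices found so far is
lexicographically largest. Hence, once the next vertex has no neighbours among the first few
vertices, the neighbourhoods of these are completely known. This is used in two ways. Ties between
vertices are resolved by degrees, and the first vertex has maximum degree and lies on the fewest
triangles among the vertices of that degree, which excludes many of the sets of neighbours to be
tried. Further, the vertices not yet found are not adjacent to the completed ones, and contain a
sparse set whose size is bounded below in terms of their number; together with a sparse set of
completed vertices this often gives one of eight vertices. The bounds (`forcesSparse_table`) come
from the same search with smaller parameters. The search is correct because it follows the order of
any given graph without rejecting it (`LexOrder.search_sound`): each rejection is justified by a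
cycle of length four or five, by the properties of the order, or by a sparse set, the latter being
constructed in `grow_sound`.

A graph on fifteen vertices arises from one of the graphs on fourteen vertices by adding a vertex,
and all ways to do so are checked to create a sparse set of eight vertices
(`forcesSparse_fifteen`). Fewer than fifteen vertices do not suffice because of the induced
subgraphs of the Heawood graph.

The Heawood graph is bipartite, hence perfect. The other two graphs are three-colourable, and a set
of vertices containing none of their six triangles is two-colourable, as is checked for all ways to
remove a vertex from each triangle; so the induced subgraphs without triangles are two-colourable
and the graphs are perfect (`isPerfectGraph_of_colorable`).

Graphs on at most fifteen vertices are represented by the natural numbers holding their adjacency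
matrices in binary, and the search is written with recursors and the arithmetic functions on `ℕ`
that the kernel evaluates on numerals.
-/

namespace SparseSearch

/-! ### Packed adjacency matrices and the search -/

/-- The number of digits `1` of a number below `2 ^ 14`: the product consists of copies of `x`, the
mask selects one digit in every four so that each digit of `x` is selected once, and reduction
modulo `15` adds up the resulting hexadecimal digits. -/
def popCount (x : ℕ) : ℕ :=
  Nat.mod (Nat.land (Nat.mul x 0x200040008001) 0x111111111111111) 15

/-- Row `i` of the adjacency matrix stored in `A`. The lowest 32 binary digits of `A` do not belong
to the matrix, see `salt`. -/
def row (A i : ℕ) : ℕ := Nat.land (Nat.shiftRight A (Nat.add (Nat.mul 16 i) 32)) 65535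

/-- The set difference of `x` and `y`, as sets of binary digits. -/
def diff (x y : ℕ) : ℕ := Nat.xor x (Nat.land x y)

/-- The entry at `n` of a table `F` of bounds, each of four binary digits. -/
def bound (F n : ℕ) : ℕ := Nat.land (Nat.shiftRight F (Nat.mul 4 n)) 15

/-- The singleton `{i}`, as a set of binary digits. -/
def bit (i : ℕ) : ℕ := Nat.shiftLeft 1 i

/-- `x` without its lowest digit `1`. -/
def dropLow (x : ℕ) : ℕ := Nat.land x (Nat.sub x 1)

/-- The position of the lowest digit `1` of `x`. -/
def lowIdx (x : ℕ) : ℕ := Nat.log2 (Nat.xor x (dropLow x))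

/-- The conditional, as a bare recursor. In the kernel this evaluates only the chosen branch. -/
def sel {α : Type} (b : Bool) (x y : α) : α := Bool.rec y x b

/-- `f n`, defined by recursion on `n` so that the kernel evaluates `n` to a numeral before it
substitutes it into `f`. -/
def force {α : Type} (n : ℕ) (f : ℕ → α) : α := Nat.rec (f 0) (fun m _ => f (Nat.succ m)) n

/-- Whether the sparse set `T` can be enlarged by `need` vertices, where `c`, `t`, `z`, `f` are as
in `GrowInv`. A candidate is either added to `T`, and then the candidates that would obtain two
neighbours or a neighbour of degree one are dropped, or it is discarded. The branch succeeds as soon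
as the sparse set of size `f` among the vertices not adjacent to `T` suffices. -/
noncomputable def grow (A F rem fuel : ℕ) : ℕ → ℕ → ℕ → ℕ → ℕ → ℕ → Bool :=
  Nat.rec (fun _ _ _ _ _ _ => false) (fun _ ih c T t z f need =>
    force c fun c =>
    sel (Nat.ble need f) true <|
    sel (Nat.blt (Nat.add (popCount c) f) need) false <|
    force (lowIdx c) fun v => force (row A v) fun r =>
    sel (ih (diff (dropLow c)
          (sel (Nat.beq (Nat.land r T) 0) (Nat.land t r)
            (Nat.lor r (row A (Nat.log2 (Nat.land r T))))))
        (Nat.lor T (bit v)) (Nat.lor t r) (diff z r)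
        (sel (Nat.beq z 0) f (bound F (Nat.add (popCount (diff z r)) rem))) (Nat.sub need 1))
      true (ih (dropLow c) T t z f need)) fuel

/-- `grow`, started from the set `{v}`. -/
noncomputable def through (A F rem v c z need : ℕ) : Bool :=
  grow A F rem 16 c (bit v) (row A v) z
    (sel (Nat.beq z 0) 0 (bound F (Nat.add (popCount z) rem))) need

/-- The result of combining with `op` the values of `g` at the binary digits `1` of a number. -/
noncomputable def foldBits {α : Type} (op : α → α → α) (e : α) (g : ℕ → α) (fuel : ℕ) : ℕ → α :=
  Nat.rec (fun _ => e) (fun _ ih x => force x fun x =>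
    sel (Nat.beq x 0) e (op (force (lowIdx x) g) (ih (dropLow x)))) fuel

/-- The union of the sets `g i`, for `i` in the set `x`. -/
noncomputable def orBits (g : ℕ → ℕ) (x : ℕ) : ℕ := foldBits Nat.lor 0 g 16 x

/-- The sum of `g i`, for `i` in the set `x`. -/
noncomputable def sumBits (g : ℕ → ℕ) (x : ℕ) : ℕ := foldBits Nat.add 0 g 16 x

/-- Whether `g i` holds for some `i` in the set `x`. -/
noncomputable def anyBits (g : ℕ → Bool) (x : ℕ) : Bool :=
  foldBits (fun a b => sel a true b) false g 16 x

/-- The vertices that cannot have a further common neighbour with `b`: those joined to `b` by a path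
of length two or three. -/
noncomputable def near (A b : ℕ) : ℕ :=
  orBits (fun w => orBits (fun u => Nat.lor (bit u) (diff (row A u) (bit w)))
    (diff (row A w) (bit b))) (row A b)

/-- A pseudorandom number below `2 ^ 32`. It is stored in the lowest digits of a code because the
kernel hashes numerals by their lowest digits. -/
noncomputable def salt (A M : ℕ) : ℕ :=
  Nat.mod (Nat.add (Nat.mul (Nat.land A 0xFFFFFFFF) 16807) M) 0x7FFFFFFF

/-- The code obtained from `A` by adding a vertex at position `p` with set of neighbours `M`. -/
noncomputable def addVertex (A p M : ℕ) : ℕ :=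
  Nat.lor (Nat.shiftLeft (Nat.lor (Nat.shiftRight A 32) (Nat.lor (Nat.shiftLeft M (Nat.mul 16 p))
    (orBits (fun w => bit (Nat.add (Nat.mul 16 w) p)) M))) 32) (salt A M)

/-- The degree of `w` in the graph stored in `A`. -/
def deg (A w : ℕ) : ℕ := popCount (row A w)

/-- Twice the number of triangles through `w`. -/
noncomputable def tri (A w : ℕ) : ℕ :=
  sumBits (fun p => popCount (Nat.land (row A p) (row A w))) (row A w)

/-- The positions `q, …, 13`, which are in use when `14 - q` vertices have been found. -/
def used (q : ℕ) : ℕ := Nat.sub 16384 (bit q)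

/-- The vertices of smaller degree than the first one. -/
noncomputable def notFull (A q : ℕ) : ℕ :=
  orBits (fun w => sel (Nat.blt (deg A w) (deg A 13)) (bit w) 0) (used q)

/-- Whether giving a further neighbour to `i` contradicts the choice of one of the vertices at
positions `i + 1, …, i + n`: that vertex and `i` were tied, and `i` would have the larger degree. -/
noncomputable def tieFail (A i n : ℕ) : Bool :=
  Nat.rec false (fun n ih =>
    sel (Nat.beq (Nat.shiftRight (row A i) (Nat.add (Nat.add i n) 2))
        (Nat.shiftRight (row A (Nat.add (Nat.add i n) 1)) (Nat.add (Nat.add i n) 2)))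
      (sel (Nat.ble (deg A (Nat.add (Nat.add i n) 1)) (deg A i)) true ih) ih) n

/-- Whether a neighbour of the last vertex has maximum degree and lies on fewer triangles than the
first vertex. This is only tested when all neighbours of the first vertex have been found. -/
noncomputable def triFail (A M : ℕ) : Bool :=
  sel (Nat.blt M 8192)
    (anyBits (fun w => sel (Nat.beq (deg A w) (deg A 13)) (Nat.blt (tri A w) (tri A 13)) false) M)
    false

/-- Whether `ok` holds for all sets consisting of `M` and elements of `X` no two of which are near
each other; sets exceeding `col` lexicographically at the positions from `sh` on are skipped. -/
noncomputable def subsets (A col sh : ℕ) (ok : ℕ → Bool) (fuel : ℕ) : ℕ → ℕ → Bool :=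
  Nat.rec (fun _ _ => false) (fun _ ih M X =>
    force M fun M =>
    sel (Nat.blt col (Nat.shiftRight M sh)) true <|
    force X fun X =>
    sel (Nat.beq X 0) (ok M) <|
    force (Nat.log2 X) fun b => force (Nat.xor X (bit b)) fun X =>
      sel (ih (Nat.lor M (bit b)) (diff X (near A b))) (ih M X) false) fuel

/-- Adds a vertex with set of neighbours `M` at position `p` and continues with `next`, unless the
new graph violates the choice of the first vertex or has a sparse set of `need + 1` vertices
containing the new one. -/
noncomputable def cand (A F need p : ℕ) (next : ℕ → Bool) (M : ℕ) : Bool :=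
  force (addVertex A p M) fun A' =>
  sel (triFail A' M) true <|
  sel (through A' F 0 p (used (Nat.succ p)) 0 need) true (next A')

/-- Whether there has to be a sparse set of `need + 1` vertices if none of the `rem` vertices not
yet found is adjacent to one at the positions `v, …, 13`. -/
noncomputable def blocked (A F need rem q v : ℕ) : Bool :=
  through A F rem v (used (Nat.succ v)) (diff (Nat.sub (bit v) (bit q)) (row A v)) need

/-- Whether `ok` holds for all admissible sets of neighbours of the next vertex with largest
element `i`. -/
noncomputable def top (A q : ℕ) (ok : ℕ → Bool) (i : ℕ) : Bool :=
  sel (Nat.blt (Nat.shiftRight (row A q) (Nat.succ q)) (Nat.shiftRight (bit i) (Nat.succ q)))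
    true <|
  sel (sel (Nat.beq i 13) true (Nat.blt (deg A i) (deg A 13)))
    (sel (tieFail A i (Nat.sub 13 i)) true
      (subsets A (Nat.shiftRight (row A q) (Nat.succ q)) (Nat.succ q) ok 16 (bit i)
        (diff (Nat.land (sel (Nat.beq i 13) (used q) (notFull A q)) (Nat.sub (bit i) 1))
          (near A i)))) true

/-- Whether `ok` holds for all admissible sets of neighbours, below `q + n`, of the next vertex. The
positions at which the largest element of that set may lie are tried in descending order, until the
graph is blocked. -/
noncomputable def tops (A F need off q : ℕ) (ok : ℕ → Bool) (n : ℕ) : Bool :=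
  Nat.rec (sel (blocked A F need (Nat.sub q off) q q) true (ok 0)) (fun n ih =>
    force (Nat.add q n) fun i =>
    sel (sel (Nat.blt i (Nat.log2 (row A q)))
      (blocked A F need (Nat.sub q off) q (Nat.succ i)) false) true
    (sel (top A q ok i) ih false)) n

/-- Whether `leaf` holds for all codes arising from the given one by adding `n` vertices, the last
of them at position `last`. The graph searched for has its vertices at positions `off, …, 13`, in
the order described in `LexOrder`, and no sparse set of `need + 1` vertices. -/
noncomputable def search (F need off last : ℕ) (leaf : ℕ → Bool) (n : ℕ) : ℕ → Bool :=
  Nat.rec leaf (fun r ih A =>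
    tops A F need off (Nat.add last (Nat.succ r)) (cand A F need (Nat.add last r) ih)
      (Nat.sub 14 (Nat.add last (Nat.succ r)))) n

/-! ### Binary digits -/

theorem force_eq {α : Type} (n : ℕ) (f : ℕ → α) : force n f = f n := by
  cases n <;> rfl

theorem sel_eq {α : Type} (b : Bool) (x y : α) : sel b x y = if b then x else y := by
  cases b <;> rfl

theorem testBit_bit (i j : ℕ) : (bit i).testBit j = decide (i = j) := by
  change (1 <<< i).testBit j = _
  rw [Nat.one_shiftLeft, Nat.testBit_two_pow]

theorem testBit_diff (x y j : ℕ) : (diff x y).testBit j = (x.testBit j && !y.testBit j) := by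
  change (x ^^^ (x &&& y)).testBit j = _
  rw [Nat.testBit_xor, Nat.testBit_land]
  cases x.testBit j <;> cases y.testBit j <;> rfl

theorem testBit_row (A i j : ℕ) :
    (row A i).testBit j = (decide (j < 16) && A.testBit (16 * i + 32 + j)) := by
  change ((A >>> (16 * i + 32)) &&& 65535).testBit j = _
  rw [Nat.testBit_land, Nat.testBit_shiftRight, show 65535 = 2 ^ 16 - 1 by norm_num,
    Nat.testBit_two_pow_sub_one, Bool.and_comm]

theorem row_testBit_lt {A i j : ℕ} (h : (row A i).testBit j = true) : j < 16 := by
  rw [testBit_row] at h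
  simp at h
  exact h.1

theorem dropLow_spec {x : ℕ} (hx : x ≠ 0) :
    ∃ k, x.testBit k = true ∧ dropLow x = x ^^^ 2 ^ k := by
  obtain ⟨k, m, hm, rfl⟩ := Nat.exists_eq_two_pow_mul_odd hx
  obtain ⟨n, rfl⟩ := hm
  refine ⟨k, by simp [Nat.testBit_two_pow_mul], ?_⟩
  change (2 ^ k * (2 * n + 1)) &&& (2 ^ k * (2 * n + 1) - 1) = _
  have hpos := Nat.two_pow_pos k
  have h1 : 2 ^ k * (2 * n + 1) - 1 = 2 ^ k * (2 * n) + (2 ^ k - 1) := by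
    rw [mul_add]; omega
  apply Nat.eq_of_testBit_eq
  intro j
  rw [Nat.testBit_land, Nat.testBit_xor, h1, Nat.testBit_two_pow_mul_add _ (by omega),
    Nat.testBit_two_pow_mul, Nat.testBit_two_pow, Nat.testBit_two_pow_sub_one]
  by_cases hj : j < k
  · simp [hj, hj.not_ge, (show k ≠ j by omega)]
  · obtain ⟨d, rfl⟩ := Nat.exists_eq_add_of_le (not_lt.mp hj)
    cases d with
    | zero => simp
    | succ d =>
      have : k ≠ k + (d + 1) := by omega
      simp [Nat.testBit_succ, Nat.mul_add_div]

theorem lowIdx_spec {x : ℕ} (hx : x ≠ 0) :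
    x.testBit (lowIdx x) = true ∧
      ∀ j, (dropLow x).testBit j = (x.testBit j && decide (j ≠ lowIdx x)) := by
  obtain ⟨k, hk, h⟩ := dropLow_spec hx
  have hl : lowIdx x = k := by
    change Nat.log2 (x ^^^ dropLow x) = k
    rw [h, ← Nat.xor_assoc, Nat.xor_self, Nat.zero_xor, Nat.log2_two_pow]
  rw [hl, h]
  refine ⟨hk, fun j => ?_⟩
  rw [Nat.testBit_xor, Nat.testBit_two_pow]
  by_cases hj : k = j
  · subst hj; simp [hk]
  · simp [hj, Ne.symm hj]

/-- The set of positions below `16` of the binary digits `1` of `x`. -/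
def ones (x : ℕ) : Finset ℕ := (Finset.range 16).filter fun i => x.testBit i = true

theorem mem_ones {x i : ℕ} : i ∈ ones x ↔ i < 16 ∧ x.testBit i = true := by
  simp [ones]

theorem mem_ones_of_lt {x n i : ℕ} (hx : x < 2 ^ n) (hn : n ≤ 16) :
    i ∈ ones x ↔ x.testBit i = true := by
  rw [mem_ones]
  refine ⟨And.right, fun h => ⟨?_, h⟩⟩
  by_contra hi
  rw [Nat.testBit_lt_two_pow (hx.trans_le (Nat.pow_le_pow_right (by norm_num) (by omega)))] at h
  cases h

theorem lt_two_pow_of_bits {x n : ℕ} (h : ∀ i, x.testBit i = true → i < n) : x < 2 ^ n := by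
  apply Nat.lt_pow_two_of_testBit
  intro i hi
  by_contra h'
  have := h i (by simpa using h')
  omega

theorem bit_lt_of_lt {x n i : ℕ} (hx : x < 2 ^ n) (h : x.testBit i = true) : i < n := by
  by_contra hi
  rw [Nat.testBit_lt_two_pow (hx.trans_le (Nat.pow_le_pow_right (by norm_num) (by omega)))] at h
  cases h

theorem dropLow_lt {x n : ℕ} (hx : x < 2 ^ n) : dropLow x < 2 ^ n :=
  (Nat.and_le_left (n := x) (m := x - 1)).trans_lt hx

theorem ones_eq_insert {x : ℕ} (hx : x ≠ 0) (h : x < 2 ^ 16) :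
    ones x = insert (lowIdx x) (ones (dropLow x)) ∧ lowIdx x ∉ ones (dropLow x) := by
  obtain ⟨h1, h2⟩ := lowIdx_spec hx
  have := bit_lt_of_lt h h1
  constructor
  · ext i
    simp only [mem_ones, Finset.mem_insert, h2]
    by_cases hi : i = lowIdx x
    · subst hi; simp [h1, this]
    · simp [hi]
  · simp [mem_ones, h2]

theorem ones_zero : ones 0 = ∅ := by simp [ones]

theorem foldBits_zero {α : Type} (op : α → α → α) (e : α) (g : ℕ → α) (fuel : ℕ) :
    foldBits op e g fuel 0 = e := by
  cases fuel <;> rfl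

theorem foldBits_succ {α : Type} (op : α → α → α) (e : α) (g : ℕ → α) (fuel : ℕ) {x : ℕ}
    (hx : x ≠ 0) : foldBits op e g (fuel + 1) x =
      op (g (lowIdx x)) (foldBits op e g fuel (dropLow x)) := by
  change force x (fun x => sel (Nat.beq x 0) e
    (op (force (lowIdx x) g) (foldBits op e g fuel (dropLow x)))) = _
  rw [force_eq, sel_eq, force_eq]
  simp [hx]

/-- Induction over the binary digits of a number, removing the lowest one at each step. -/
theorem foldBits_induction {α : Type} (op : α → α → α) (e : α) (g : ℕ → α)
    (P : Finset ℕ → α → Prop) (h0 : P ∅ e)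
    (hs : ∀ i s a, i ∉ s → P s a → P (insert i s) (op (g i) a)) {x : ℕ} (hx : x < 2 ^ 16) :
    P (ones x) (foldBits op e g 16 x) := by
  suffices H : ∀ k x, x < 2 ^ 16 → (ones x).card ≤ k → P (ones x) (foldBits op e g k x) by
    exact H 16 x hx ((Finset.card_filter_le _ _).trans (by simp))
  intro k
  induction k with
  | zero =>
    intro x hx hk
    have : ones x = ∅ := by simpa using hk
    rw [this]; exact h0
  | succ k ih =>
    intro x hx hk
    by_cases h : x = 0
    · subst h
      rw [foldBits_zero, ones_zero]; exact h0
    · obtain ⟨h1, h2⟩ := ones_eq_insert h hx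
      rw [foldBits_succ _ _ _ _ h, h1]
      refine hs _ _ _ h2 (ih _ (dropLow_lt hx) ?_)
      rw [h1, Finset.card_insert_of_notMem h2] at hk
      omega

theorem testBit_orBits (g : ℕ → ℕ) {x : ℕ} (hx : x < 2 ^ 16) (j : ℕ) :
    (orBits g x).testBit j = true ↔ ∃ i ∈ ones x, (g i).testBit j = true := by
  refine foldBits_induction Nat.lor 0 g
    (fun s a => a.testBit j = true ↔ ∃ i ∈ s, (g i).testBit j = true) (by simp) ?_ hx
  intro i s a _ h
  change (g i ||| a).testBit j = true ↔ _
  simp [h]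

theorem sumBits_eq (g : ℕ → ℕ) {x : ℕ} (hx : x < 2 ^ 16) :
    sumBits g x = ∑ i ∈ ones x, g i := by
  refine foldBits_induction Nat.add 0 g (fun s a => a = ∑ i ∈ s, g i) (by simp) ?_ hx
  intro i s a hi h
  rw [Finset.sum_insert hi, ← h]
  rfl

theorem anyBits_iff (g : ℕ → Bool) {x : ℕ} (hx : x < 2 ^ 16) :
    anyBits g x = true ↔ ∃ i ∈ ones x, g i = true := by
  refine foldBits_induction (fun a b => sel a true b) false g
    (fun s a => a = true ↔ ∃ i ∈ s, g i = true) (by simp) ?_ hx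
  intro i s a _ h
  simp only [sel_eq]
  simp [← h]

theorem popCount_digits {x : ℕ} (hx : x < 8192) : popCount (2 * x) = popCount x ∧
    popCount (2 * x + 1) = popCount x + 1 := by
  have h : ∀ a < 64, ∀ b < 128,
      popCount (2 * (128 * a + b)) = popCount (128 * a + b) ∧
        popCount (2 * (128 * a + b) + 1) = popCount (128 * a + b) + 1 := by
    decide +kernel
  have := h (x / 128) (by omega) (x % 128) (by omega)
  rwa [Nat.div_add_mod] at this

theorem card_ones_bit (x : ℕ) (hx : x < 2 ^ 15) (b : Bool) :
    (ones (2 * x + b.toNat)).card = (ones x).card + b.toNat := by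
  have h : ones (2 * x + b.toNat) =
      (ones x).map ⟨Nat.succ, Nat.succ_injective⟩ ∪ (if b then {0} else ∅) := by
    ext i
    rw [mem_ones, Finset.mem_union, Finset.mem_map]
    cases i with
    | zero => cases b <;> simp
    | succ i =>
      have : (2 * x + b.toNat) / 2 = x := by cases b <;> simp; omega
      rw [Nat.testBit_succ, this]
      have h0 : i + 1 ∉ (if b then ({0} : Finset ℕ) else ∅) := by cases b <;> simp
      simp only [h0, or_false, Function.Embedding.coeFn_mk, Nat.succ_eq_add_one,
        Nat.add_right_cancel_iff, exists_eq_right]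
      rw [mem_ones]
      constructor
      · rintro ⟨_, h2⟩
        exact ⟨by omega, h2⟩
      · rintro ⟨_, h2⟩
        exact ⟨by have := bit_lt_of_lt hx h2; omega, h2⟩
  rw [h, Finset.card_union_of_disjoint, Finset.card_map]
  · cases b <;> simp
  · rw [Finset.disjoint_left]
    intro i hi
    cases b <;> simp at hi ⊢
    obtain ⟨a, _, rfl⟩ := hi
    omega

theorem popCount_eq {x : ℕ} (hx : x < 2 ^ 14) : popCount x = (ones x).card := by
  induction x using Nat.strong_induction_on with
  | _ x ih =>
    rcases Nat.eq_zero_or_pos x with rfl | hpos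
    · rw [ones_zero]; rfl
    · obtain ⟨h0, h1⟩ := popCount_digits (x := x / 2) (by omega)
      have hi := ih (x / 2) (by omega) (by omega)
      rcases Nat.mod_two_eq_zero_or_one x with h | h
      · have e := card_ones_bit (x / 2) (by omega) false
        have : 2 * (x / 2) = x := by omega
        rw [Bool.toNat_false, add_zero, add_zero, this] at e
        rw [e, ← hi, ← h0, this]
      · have e := card_ones_bit (x / 2) (by omega) true
        have : 2 * (x / 2) + 1 = x := by omega
        rw [Bool.toNat_true, this] at e
        rw [e, ← hi, ← h1, this]

theorem testBit_used {q : ℕ} (hq : q ≤ 14) (i : ℕ) :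
    (used q).testBit i = true ↔ q ≤ i ∧ i < 14 := by
  have h : used q = 2 ^ q * (2 ^ (14 - q) - 1) := by
    change 16384 - 1 <<< q = _
    rw [Nat.one_shiftLeft, Nat.mul_sub, ← pow_add, show q + (14 - q) = 14 by omega]
    simp
  rw [h, Nat.testBit_two_pow_mul, Nat.testBit_two_pow_sub_one]
  simp
  omega

theorem testBit_bit_sub_bit {q v : ℕ} (h : q ≤ v) (i : ℕ) :
    (Nat.sub (bit v) (bit q)).testBit i = true ↔ q ≤ i ∧ i < v := by
  have h : Nat.sub (bit v) (bit q) = 2 ^ q * (2 ^ (v - q) - 1) := by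
    change 1 <<< v - 1 <<< q = _
    rw [Nat.one_shiftLeft, Nat.one_shiftLeft, Nat.mul_sub, ← pow_add, show q + (v - q) = v by omega]
    simp
  rw [h, Nat.testBit_two_pow_mul, Nat.testBit_two_pow_sub_one]
  simp
  omega

/-! ### Sparse sets and their extension -/

open Finset

variable {V : Type*}

/-- A set of vertices inducing a graph of maximum degree at most one. -/
def Sparse (G : SimpleGraph V) (S : Finset V) : Prop :=
  ∀ v ∈ S, ∀ u ∈ S, ∀ w ∈ S, G.Adj v u → G.Adj v w → u = w

/-- The graph contains neither a cycle of length four nor one of length five, induced or not. -/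
structure NoFourFiveCycle (G : SimpleGraph V) : Prop where
  four : ∀ a b c d, G.Adj a b → G.Adj b c → G.Adj c d → G.Adj d a → a = c ∨ b = d
  five : ∀ a b c d e, G.Adj a b → G.Adj b c → G.Adj c d → G.Adj d e → G.Adj e a →
    a ≠ c → a ≠ d → b ≠ d → b ≠ e → c ≠ e → False

/-- The number `A` stores the graph induced by `G` on the vertices `φ i` with `i ∈ L`: these are
distinct, and the `i`-th row of `A` consists of the neighbours of `φ i`. -/
structure IsCode (G : SimpleGraph V) (φ : ℕ → V) (L : Set ℕ) (A : ℕ) : Prop where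
  inj : Set.InjOn φ L
  lt : ∀ i ∈ L, i < 16
  row_iff : ∀ i j, (row A i).testBit j = true ↔ i ∈ L ∧ j ∈ L ∧ G.Adj (φ i) (φ j)

theorem Sparse.subset {G : SimpleGraph V} {S T : Finset V} (h : Sparse G S) (hT : T ⊆ S) :
    Sparse G T :=
  fun v hv u hu w hw => h v (hT hv) u (hT hu) w (hT hw)

theorem Sparse.union [DecidableEq V] {G : SimpleGraph V} {S T : Finset V} (hS : Sparse G S)
    (hT : Sparse G T) (h : ∀ s ∈ S, ∀ t ∈ T, ¬ G.Adj s t) : Sparse G (S ∪ T) := by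
  have h' : ∀ s ∈ S, ∀ t ∈ T, ¬ G.Adj t s := fun s hs t ht e => h s hs t ht e.symm
  intro v hv u hu w hw e1 e2
  rcases mem_union.1 hv with hv | hv <;> rcases mem_union.1 hu with hu | hu <;>
    rcases mem_union.1 hw with hw | hw
  · exact hS v hv u hu w hw e1 e2
  · exact (h _ hv _ hw e2).elim
  · exact (h _ hv _ hu e1).elim
  · exact (h _ hv _ hu e1).elim
  · exact (h' _ hu _ hv e1).elim
  · exact (h' _ hu _ hv e1).elim
  · exact (h' _ hw _ hv e2).elim
  · exact hT v hv u hu w hw e1 e2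

/-- A vertex can be added to a sparse set when it has at most one neighbour there, and that
neighbour is isolated in the set. -/
theorem Sparse.insert [DecidableEq V] {G : SimpleGraph V} {S : Finset V} (hS : Sparse G S) {x : V}
    (h : ∀ a ∈ S, G.Adj x a → (∀ b ∈ S, G.Adj x b → b = a) ∧ ∀ b ∈ S, ¬ G.Adj a b) :
    Sparse G (insert x S) := by
  intro v hv u hu w hw e1 e2
  rcases mem_insert.1 hv with rfl | hv'
  · rcases mem_insert.1 hu with rfl | hu'
    · exact (G.loopless.irrefl _ e1).elim
    · rcases mem_insert.1 hw with rfl | hw'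
      · exact (G.loopless.irrefl _ e2).elim
      · exact ((h u hu' e1).1 w hw' e2).symm
  · rcases mem_insert.1 hu with rfl | hu'
    · rcases mem_insert.1 hw with rfl | hw'
      · rfl
      · exact ((h v hv' e1.symm).2 w hw' e2).elim
    · rcases mem_insert.1 hw with rfl | hw'
      · exact ((h v hv' e2.symm).2 u hu' e1).elim
      · exact hS v hv' u hu' w hw' e1 e2

theorem exists_sparse_card_eq {G : SimpleGraph V} {S : Finset V} (h : Sparse G S) {n : ℕ}
    (hn : n ≤ S.card) : ∃ T ⊆ S, Sparse G T ∧ T.card = n := by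
  obtain ⟨T, hT, hc⟩ := exists_subset_card_eq hn
  exact ⟨T, hT, h.subset hT, hc⟩

section Grow

variable [DecidableEq V] {G : SimpleGraph V} {φ : ℕ → V} {L : Set ℕ} {A : ℕ} {E : Finset V}

/-- The situation in which `grow` is called: `T` is a sparse set of labelled vertices, `c` consists
of vertices each of which can be added to `T`, `t` contains those elements of `c` that have a
neighbour in `T`, the vertices in `z` and in `E` have no neighbours in `T`, and `f` is the size of a
sparse set among the latter. -/
structure GrowInv (G : SimpleGraph V) (φ : ℕ → V) (L : Set ℕ) (E : Finset V)
    (c T t z f : ℕ) : Prop where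
  c_mem : ∀ i, c.testBit i = true → i ∈ L
  T_mem : ∀ i, T.testBit i = true → i ∈ L
  z_mem : ∀ i, z.testBit i = true → i ∈ L ∧ i < 14
  c_T : ∀ i, c.testBit i = true → T.testBit i = true → False
  z_T : ∀ i, z.testBit i = true → T.testBit i = true → False
  c_z : ∀ i, c.testBit i = true → z.testBit i = true → False
  sparse : Sparse G ((ones T).image φ)
  cand : ∀ i, c.testBit i = true → ∀ a, T.testBit a = true → G.Adj (φ i) (φ a) →
    t.testBit i = true ∧ (∀ b, T.testBit b = true → G.Adj (φ i) (φ b) → b = a) ∧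
      ∀ b, T.testBit b = true → ¬ G.Adj (φ a) (φ b)
  z_nadj : ∀ i, z.testBit i = true → ∀ a, T.testBit a = true → ¬ G.Adj (φ i) (φ a)
  E_nadj : ∀ e ∈ E, ∀ i, (c.testBit i = true ∨ T.testBit i = true) → ¬ G.Adj e (φ i)
  rest : ∃ S ⊆ (ones z).image φ ∪ E, Sparse G S ∧ S.card = f

theorem image_insert_bit {φ : ℕ → V} {T v : ℕ} (hv : v < 16) :
    (ones (Nat.lor T (bit v))).image φ = insert (φ v) ((ones T).image φ) := by
  rw [← image_insert]
  congr 1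
  ext i
  rw [mem_insert, mem_ones, mem_ones]
  change i < 16 ∧ (T ||| bit v).testBit i = true ↔ _
  rw [Nat.testBit_or, testBit_bit]
  by_cases h : v = i
  · subst h
    exact ⟨fun _ => Or.inl rfl, fun _ => ⟨hv, by rw [decide_eq_true rfl, Bool.or_true]⟩⟩
  · rw [decide_eq_false h, Bool.or_false]
    exact ⟨fun h' => Or.inr h', fun h' => h'.resolve_left (Ne.symm h)⟩

theorem sel_true_left {b : Bool} {x : Bool} : sel b true x = true ↔ b = true ∨ x = true := by
  rw [sel_eq]; cases b <;> simp

theorem sel_false_left {b : Bool} {x : Bool} :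
    sel b false x = true ↔ b = false ∧ x = true := by
  rw [sel_eq]; cases b <;> simp

theorem sel_false_right {b : Bool} {x : Bool} :
    sel b x false = true ↔ b = true ∧ x = true := by
  rw [sel_eq]; cases b <;> simp

/-- One step of `grow`: `v` is moved from the candidates to the sparse set. -/
theorem GrowInv.step (hA : IsCode G φ L A) {c d T t z f f' v : ℕ}
    (h : GrowInv G φ L E c T t z f) (hv : c.testBit v = true)
    (hd : ∀ i, d.testBit i = true → c.testBit i = true ∧ i ≠ v)
    (hf : ∃ S ⊆ (ones (diff z (row A v))).image φ ∪ E, Sparse G S ∧ S.card = f') :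
    GrowInv G φ L E (diff d (sel (Nat.beq (Nat.land (row A v) T) 0) (Nat.land t (row A v))
        (Nat.lor (row A v) (row A (Nat.log2 (Nat.land (row A v) T))))))
      (Nat.lor T (bit v)) (Nat.lor t (row A v)) (diff z (row A v)) f' := by
  have hvL := h.c_mem v hv
  have hT : ∀ i, (Nat.lor T (bit v)).testBit i = true ↔ T.testBit i = true ∨ i = v := by
    intro i
    change (T ||| bit v).testBit i = true ↔ _
    rw [Nat.testBit_or, testBit_bit, Bool.or_eq_true, decide_eq_true_iff, eq_comm (a := v)]
  have ht : ∀ i, (Nat.lor t (row A v)).testBit i = true ↔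
      t.testBit i = true ∨ (row A v).testBit i = true := by
    intro i
    change (t ||| row A v).testBit i = true ↔ _
    simp
  have hr : ∀ i, (row A v).testBit i = true ↔ i ∈ L ∧ G.Adj (φ v) (φ i) := by
    intro i; rw [hA.row_iff]; tauto
  have hz : ∀ i, (diff z (row A v)).testBit i = true ↔
      z.testBit i = true ∧ ¬ (row A v).testBit i = true := by
    intro i; rw [testBit_diff]; simp
  generalize hM : (sel (Nat.beq (Nat.land (row A v) T) 0) (Nat.land t (row A v))
        (Nat.lor (row A v) (row A (Nat.log2 (Nat.land (row A v) T))))) = M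
  have hc : ∀ i, (diff d M).testBit i = true →
      c.testBit i = true ∧ i ≠ v ∧ ¬ M.testBit i = true := by
    intro i hi
    rw [testBit_diff] at hi
    simp at hi
    exact ⟨(hd i hi.1).1, (hd i hi.1).2, by simp [hi.2]⟩
  refine ⟨fun i hi => h.c_mem i (hc i hi).1, ?_, fun i hi => h.z_mem i ((hz i).1 hi).1, ?_, ?_, ?_,
    ?_, ?_, ?_, ?_, hf⟩
  · intro i hi
    rcases (hT i).1 hi with hi | rfl
    · exact h.T_mem i hi
    · exact hvL
  · intro i hi hi'
    rcases (hT i).1 hi' with h1 | h1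
    · exact h.c_T i (hc i hi).1 h1
    · exact (hc i hi).2.1 h1
  · intro i hi hi'
    rcases (hT i).1 hi' with h1 | rfl
    · exact h.z_T i ((hz i).1 hi).1 h1
    · exact h.c_z i hv ((hz i).1 hi).1
  · intro i hi hi'
    exact h.c_z i (hc i hi).1 ((hz i).1 hi').1
  · rw [image_insert_bit (hA.lt v hvL)]
    refine h.sparse.insert ?_
    intro a ha hadj
    obtain ⟨i, hi, rfl⟩ := mem_image.1 ha
    obtain ⟨h1, h2, h3⟩ := h.cand v hv i (mem_ones.1 hi).2 hadj
    refine ⟨?_, ?_⟩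
    · intro b hb hadj'
      obtain ⟨j, hj, rfl⟩ := mem_image.1 hb
      rw [h2 j (mem_ones.1 hj).2 hadj']
    · intro b hb
      obtain ⟨j, hj, rfl⟩ := mem_image.1 hb
      exact h3 j (mem_ones.1 hj).2
  · intro i hi a ha hadj
    obtain ⟨hic, hiv, hiM⟩ := hc i hi
    have hiL := h.c_mem i hic
    rw [ht]
    by_cases h0 : Nat.land (row A v) T = 0
    · -- `v` has no neighbours in the old set: the new candidates avoid `t ∩ N(v)`, so none of them
      -- has neighbours both in the old set and at `v`
      have hvT : ∀ b, T.testBit b = true → ¬ G.Adj (φ v) (φ b) := by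
        intro b hb hadj'
        have : (Nat.land (row A v) T).testBit b = true := by
          change (row A v &&& T).testBit b = true
          rw [Nat.testBit_and, hb, (hr b).2 ⟨h.T_mem b hb, hadj'⟩]; rfl
        rw [h0] at this; simp at this
      have hM' : ¬ (t.testBit i = true ∧ (row A v).testBit i = true) := by
        rw [h0] at hM
        rw [← hM] at hiM
        change ¬ (t &&& row A v).testBit i = true at hiM
        simpa using hiM
      rcases (hT a).1 ha with haT | rfl
      · obtain ⟨h1, h2, h3⟩ := h.cand i hic a haT hadj
        refine ⟨Or.inl h1, ?_, ?_⟩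
        · intro b hb hadj'
          rcases (hT b).1 hb with hb | rfl
          · exact h2 b hb hadj'
          · exact (hM' ⟨h1, (hr i).2 ⟨hiL, hadj'.symm⟩⟩).elim
        · intro b hb hadj'
          rcases (hT b).1 hb with hb | rfl
          · exact h3 b hb hadj'
          · exact hvT a haT hadj'.symm
      · have hri := (hr i).2 ⟨hiL, hadj.symm⟩
        refine ⟨Or.inr hri, ?_, ?_⟩
        · intro b hb hadj'
          rcases (hT b).1 hb with hb | rfl
          · exact (hM' ⟨(h.cand i hic b hb hadj').1, hri⟩).elim
          · rfl
        · intro b hb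
          rcases (hT b).1 hb with hb | rfl
          · exact hvT b hb
          · exact G.loopless.irrefl _
    · -- `v` has a unique neighbour `a0` in the old set, and no new candidate is adjacent to either
      have hl := Nat.testBit_log2 h0
      generalize Nat.log2 (Nat.land (row A v) T) = a0 at hl hM
      have hl' : (row A v).testBit a0 = true ∧ T.testBit a0 = true := by
        change (row A v &&& T).testBit a0 = true at hl
        simpa using hl
      obtain ⟨ha0L, ha0⟩ := (hr a0).1 hl'.1
      have hM' : ¬ (row A v).testBit i = true ∧ ¬ (row A a0).testBit i = true := by
        rw [sel_eq, show Nat.beq (Nat.land (row A v) T) 0 = false by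
          rw [← Bool.not_eq_true]; simpa using h0] at hM
        simp only [Bool.false_eq_true, if_false] at hM
        rw [← hM] at hiM
        change ¬ (row A v ||| row A a0).testBit i = true at hiM
        simpa using hiM
      obtain ⟨-, hu, -⟩ := h.cand v hv a0 hl'.2 ha0
      have hnv : ¬ G.Adj (φ i) (φ v) := fun e => hM'.1 ((hr i).2 ⟨hiL, e.symm⟩)
      have hna : ¬ G.Adj (φ i) (φ a0) := fun e =>
        hM'.2 ((hA.row_iff a0 i).2 ⟨ha0L, hiL, e.symm⟩)
      rcases (hT a).1 ha with haT | rfl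
      · obtain ⟨h1, h2, h3⟩ := h.cand i hic a haT hadj
        refine ⟨Or.inl h1, ?_, ?_⟩
        · intro b hb hadj'
          rcases (hT b).1 hb with hb | rfl
          · exact h2 b hb hadj'
          · exact (hnv hadj').elim
        · intro b hb hadj'
          rcases (hT b).1 hb with hb | rfl
          · exact h3 b hb hadj'
          · have := hu a haT hadj'.symm
            subst this
            exact hna hadj
      · exact (hnv hadj).elim
  · intro i hi a ha
    obtain ⟨h1, h2⟩ := (hz i).1 hi
    rcases (hT a).1 ha with ha | rfl
    · exact h.z_nadj i h1 a ha
    · intro e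
      exact h2 ((hr i).2 ⟨(h.z_mem i h1).1, e.symm⟩)
  · intro e he i hi
    rcases hi with hi | hi
    · exact h.E_nadj e he i (Or.inl (hc i hi).1)
    · rcases (hT i).1 hi with hi | rfl
      · exact h.E_nadj e he i (Or.inr hi)
      · exact h.E_nadj e he i (Or.inl hv)

theorem card_image_ones {x : ℕ} (hφ : Set.InjOn φ L) (hx : ∀ i, x.testBit i = true → i ∈ L) :
    ((ones x).image φ).card = (ones x).card :=
  card_image_of_injOn (hφ.mono fun i hi => hx i (mem_ones.1 hi).2)

theorem image_ones_disjoint {x y : ℕ} (hφ : Set.InjOn φ L)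
    (hx : ∀ i, x.testBit i = true → i ∈ L) (hy : ∀ i, y.testBit i = true → i ∈ L)
    (h : ∀ i, x.testBit i = true → y.testBit i = true → False) :
    Disjoint ((ones x).image φ) ((ones y).image φ) := by
  rw [disjoint_left]
  intro v hv hv'
  obtain ⟨i, hi, rfl⟩ := mem_image.1 hv
  obtain ⟨j, hj, e⟩ := mem_image.1 hv'
  have hi := (mem_ones.1 hi).2
  have hj := (mem_ones.1 hj).2
  have := hφ (hy j hj) (hx i hi) e
  subst this
  exact h j hi hj

/-- The table `F` underestimates the sizes of sparse sets among a set `X` of vertices omitting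
`x`. -/
def TableValid (G : SimpleGraph V) (F : ℕ) (x : V) : Prop :=
  ∀ X : Finset V, x ∉ X → ∃ S ⊆ X, Sparse G S ∧ S.card = bound F X.card

theorem TableValid.rest {F z v : ℕ} (hF : TableValid G F (φ v)) (hA : IsCode G φ L A)
    (hvL : v ∈ L) (hE : ∀ e ∈ E, ∀ i ∈ L, e ≠ φ i)
    (hz : ∀ i, z.testBit i = true → i ∈ L ∧ i < 14) (hzv : ¬ z.testBit v = true) :
    ∃ S ⊆ (ones z).image φ ∪ E, Sparse G S ∧ S.card = bound F (Nat.add (popCount z) E.card) := by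
  have hz16 : z < 2 ^ 14 := lt_two_pow_of_bits fun i hi => (hz i hi).2
  have hcard : ((ones z).image φ ∪ E).card = Nat.add (popCount z) E.card := by
    rw [card_union_of_disjoint, card_image_ones hA.inj fun i hi => (hz i hi).1, popCount_eq hz16]
    · rfl
    · rw [disjoint_left]
      intro x hx hx'
      obtain ⟨i, hi, rfl⟩ := mem_image.1 hx
      exact hE _ hx' i (hz i (mem_ones.1 hi).2).1 rfl
  rw [← hcard]
  apply hF
  rw [mem_union, not_or]
  constructor
  · intro h
    obtain ⟨i, hi, e⟩ := mem_image.1 h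
    have hi := (mem_ones.1 hi).2
    exact hzv (hA.inj (hz i hi).1 hvL e ▸ hi)
  · intro h
    exact hE _ h v hvL rfl

theorem grow_sound {F v : ℕ} (hA : IsCode G φ L A) (hvL : v ∈ L) (hF : TableValid G F (φ v))
    (hE : ∀ e ∈ E, ∀ i ∈ L, e ≠ φ i) :
    ∀ fuel c T t z f need, grow A F E.card fuel c T t z f need = true → T.testBit v = true →
      GrowInv G φ L E c T t z f →
      ∃ S, Sparse G S ∧ S.card = ((ones T).image φ).card + need := by
  intro fuel
  induction fuel with
  | zero => intro c T t z f need h; cases h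
  | succ fuel ih =>
    intro c T t z f need h hvT inv
    change force c (fun c =>
      sel (Nat.ble need f) true <|
      sel (Nat.blt (Nat.add (popCount c) f) need) false <|
      force (lowIdx c) fun v => force (row A v) fun r =>
      sel (grow A F E.card fuel (diff (dropLow c)
            (sel (Nat.beq (Nat.land r T) 0) (Nat.land t r)
              (Nat.lor r (row A (Nat.log2 (Nat.land r T))))))
          (Nat.lor T (bit v)) (Nat.lor t r) (diff z r)
          (sel (Nat.beq z 0) f (bound F (Nat.add (popCount (diff z r)) E.card))) (Nat.sub need 1))
        true (grow A F E.card fuel (dropLow c) T t z f need)) = true at h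
    simp only [force_eq, sel_true_left, sel_false_left] at h
    by_cases hnf : need ≤ f
    · obtain ⟨S, hS, hSs, hc⟩ := inv.rest
      obtain ⟨S', hS', hSs', hc'⟩ := exists_sparse_card_eq hSs (hc ▸ hnf)
      refine ⟨(ones T).image φ ∪ S', inv.sparse.union hSs' ?_, ?_⟩
      · intro s hs t ht
        obtain ⟨a, ha, rfl⟩ := mem_image.1 hs
        have ha := (mem_ones.1 ha).2
        rcases mem_union.1 (hS (hS' ht)) with ht | ht
        · obtain ⟨b, hb, rfl⟩ := mem_image.1 ht
          exact fun e => inv.z_nadj b (mem_ones.1 hb).2 a ha e.symm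
        · exact fun e => inv.E_nadj t ht a (Or.inr ha) e.symm
      · rw [card_union_of_disjoint, hc']
        refine disjoint_of_subset_right (hS'.trans hS) ?_
        rw [disjoint_union_right]
        refine ⟨image_ones_disjoint hA.inj inv.T_mem (fun i hi => (inv.z_mem i hi).1)
          fun i h1 h2 => inv.z_T i h2 h1, ?_⟩
        rw [disjoint_left]
        intro x hx hx'
        obtain ⟨i, hi, rfl⟩ := mem_image.1 hx
        exact hE _ hx' i (inv.T_mem i (mem_ones.1 hi).2) rfl
    · rcases h with h | ⟨h1, h2⟩
      · exact (hnf (Nat.le_of_ble_eq_true h)).elim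
      have hc0 : c ≠ 0 := by
        rintro rfl
        have : Nat.blt (Nat.add (popCount 0) f) need = true := by
          rw [show Nat.add (popCount 0) f = f from Nat.zero_add f]
          exact Nat.ble_eq_true_of_le (not_le.mp hnf)
        rw [this] at h1
        cases h1
      obtain ⟨hv, hd⟩ := lowIdx_spec hc0
      have hd' : ∀ i, (dropLow c).testBit i = true → c.testBit i = true ∧ i ≠ lowIdx c := by
        intro i hi; rw [hd] at hi; simpa using hi
      rcases h2 with h2 | h2
      · have hf' : ∃ S ⊆ (ones (diff z (row A (lowIdx c)))).image φ ∪ E, Sparse G S ∧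
            S.card = sel (Nat.beq z 0) f
              (bound F (Nat.add (popCount (diff z (row A (lowIdx c)))) E.card)) := by
          rw [sel_eq]
          by_cases hz : z = 0
          · subst hz
            have : diff 0 (row A (lowIdx c)) = 0 := by
              apply Nat.eq_of_testBit_eq; intro i; rw [testBit_diff]; simp
            rw [this]
            exact inv.rest
          · rw [if_neg (by simpa using hz)]
            refine hF.rest hA hvL hE ?_ ?_
            · intro i hi
              rw [testBit_diff] at hi
              simp at hi
              exact inv.z_mem i hi.1
            · intro hi
              rw [testBit_diff] at hi
              simp at hi
              exact inv.z_T v hi.1 hvT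
        have inv' := inv.step hA hv hd' hf'
        obtain ⟨S, hS, hc⟩ := ih _ _ _ _ _ _ h2 (by
          change (T ||| bit _).testBit v = true
          rw [Nat.testBit_or, hvT]; rfl) inv'
        refine ⟨S, hS, ?_⟩
        have hvc := inv.c_mem _ hv
        rw [hc, image_insert_bit (hA.lt _ hvc), card_insert_of_notMem]
        · change _ + 1 + (need - 1) = _
          omega
        · intro hx
          obtain ⟨i, hi, e⟩ := mem_image.1 hx
          have hi := (mem_ones.1 hi).2
          have := hA.inj (inv.T_mem i hi) hvc e
          subst this
          exact inv.c_T _ hv hi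
      · refine ih _ _ _ _ _ _ h2 hvT { inv with
          c_mem := fun i hi => inv.c_mem i (hd' i hi).1
          c_T := fun i hi => inv.c_T i (hd' i hi).1
          c_z := fun i hi => inv.c_z i (hd' i hi).1
          cand := fun i hi => inv.cand i (hd' i hi).1
          E_nadj := fun e he i hi => inv.E_nadj e he i (hi.imp_left fun h => (hd' i h).1) }

/-- If `through` succeeds then there is a sparse set of `need + 1` vertices containing `φ v`. -/
theorem through_sound {F v c z need : ℕ} (hA : IsCode G φ L A) (hvL : v ∈ L)
    (hF : TableValid G F (φ v)) (hE : ∀ e ∈ E, ∀ i ∈ L, e ≠ φ i)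
    (hc : ∀ i, c.testBit i = true → i ∈ L ∧ i ≠ v)
    (hz : ∀ i, z.testBit i = true → i ∈ L ∧ i < 14 ∧ i ≠ v ∧ ¬ G.Adj (φ i) (φ v))
    (hcz : ∀ i, c.testBit i = true → z.testBit i = true → False)
    (hEv : ∀ e ∈ E, ∀ i, c.testBit i = true ∨ i = v → ¬ G.Adj e (φ i))
    (h : through A F E.card v c z need = true) : ∃ S, Sparse G S ∧ S.card = need + 1 := by
  have hb : ∀ i, (bit v).testBit i = true ↔ i = v := by
    intro i; rw [testBit_bit]; simp [eq_comm]
  have hone : (ones (bit v)).image φ = {φ v} := by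
    have : ones (bit v) = {v} := by
      ext i; rw [mem_ones, hb, mem_singleton]
      exact ⟨fun h => h.2, fun h => ⟨h ▸ hA.lt v hvL, h⟩⟩
    rw [this, image_singleton]
  have inv : GrowInv G φ L E c (bit v) (row A v) z
      (sel (Nat.beq z 0) 0 (bound F (Nat.add (popCount z) E.card))) := by
    refine ⟨fun i hi => (hc i hi).1, ?_, fun i hi => ⟨(hz i hi).1, (hz i hi).2.1⟩, ?_, ?_, hcz, ?_,
      ?_, ?_, ?_, ?_⟩
    · intro i hi; rw [(hb i).1 hi]; exact hvL
    · intro i hi hi'; exact (hc i hi).2 ((hb i).1 hi')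
    · intro i hi hi'; exact (hz i hi).2.2.1 ((hb i).1 hi')
    · rw [hone]
      intro a ha u hu w hw _ _
      rw [mem_singleton.1 hu, mem_singleton.1 hw]
    · intro i hi a ha hadj
      rw [(hb a).1 ha] at hadj ⊢
      refine ⟨(hA.row_iff v i).2 ⟨hvL, (hc i hi).1, hadj.symm⟩, fun b hb' _ => (hb b).1 hb', ?_⟩
      intro b hb'
      rw [(hb b).1 hb']
      exact G.loopless.irrefl _
    · intro i hi a ha
      rw [(hb a).1 ha]
      exact (hz i hi).2.2.2
    · intro e he i hi
      exact hEv e he i (hi.imp_right fun h => (hb i).1 h)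
    · rw [sel_eq]
      split_ifs with h0
      · exact ⟨∅, by simp, by intro v hv; simp at hv, rfl⟩
      · exact hF.rest hA hvL hE (fun i hi => ⟨(hz i hi).1, (hz i hi).2.1⟩)
          fun hi => (hz v hi).2.2.1 rfl
  obtain ⟨S, hS, hcard⟩ := grow_sound hA hvL hF hE _ _ _ _ _ _ _ h ((hb v).2 rfl) inv
  refine ⟨S, hS, ?_⟩
  rw [hcard, hone, card_singleton, add_comm]

end Grow

/-- A vertex `x` other than the coded ones is not adjacent to two vertices at distance two or
joined by a path of length three. -/
theorem near_sound {G : SimpleGraph V} {φ : ℕ → V} {L : Set ℕ} {A : ℕ} (hG : NoFourFiveCycle G)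
    (hA : IsCode G φ L A) {x : V} (hx : ∀ i ∈ L, x ≠ φ i) {b c : ℕ} (hbc : b ≠ c) (hb : b ∈ L)
    (hc : c ∈ L) (hxb : G.Adj x (φ b)) (hxc : G.Adj x (φ c)) : ¬ (near A b).testBit c = true := by
  have hrow : ∀ i, row A i < 2 ^ 16 := fun i => lt_two_pow_of_bits fun j hj => row_testBit_lt hj
  have hdiff : ∀ i y, diff (row A i) y < 2 ^ 16 := fun i y => lt_two_pow_of_bits fun j hj => by
    rw [testBit_diff, Bool.and_eq_true] at hj
    exact row_testBit_lt hj.1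
  intro h
  obtain ⟨w, hw, h⟩ := (testBit_orBits _ (hrow b) c).1 h
  obtain ⟨u, hu, h⟩ := (testBit_orBits _ (hdiff w _) c).1 h
  obtain ⟨-, hwL, hbw⟩ := (hA.row_iff b w).1 (mem_ones.1 hw).2
  have hu := (mem_ones.1 hu).2
  rw [testBit_diff, testBit_bit] at hu
  simp at hu
  obtain ⟨-, huL, hwu⟩ := (hA.row_iff w u).1 hu.1
  change (bit u ||| diff (row A u) (bit w)).testBit c = true at h
  rw [Nat.testBit_or, testBit_bit, testBit_diff, testBit_bit] at h
  have hne : ∀ {i j}, i ∈ L → j ∈ L → i ≠ j → φ i ≠ φ j := fun hi hj h e => h (hA.inj hi hj e)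
  by_cases huc : u = c
  · subst huc
    rcases hG.four _ _ _ _ hbw hwu hxc.symm hxb with h | h
    · exact hne hb huL hbc h
    · exact hx w hwL h.symm
  · simp [huc] at h
    obtain ⟨-, -, huc'⟩ := (hA.row_iff u c).1 h.1
    refine hG.five _ _ _ _ _ hbw hwu huc' hxc.symm hxb (hne hb huL hu.2) (hne hb hc hbc)
      (hne hwL hc h.2) (hx w hwL).symm (hx u huL).symm

/-! ### Lexicographic breadth-first orders -/

open Classical in
/-- The digit `1` of this number at the positions `j` with `i < j < 14` marks the neighbours `φ j`
of `v`. -/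
noncomputable def later (G : SimpleGraph V) (φ : ℕ → V) (i : ℕ) (v : V) : ℕ :=
  Nat.ofBits fun j : Fin 14 => decide (i < j.val ∧ G.Adj v (φ j))

theorem testBit_later (G : SimpleGraph V) (φ : ℕ → V) (i : ℕ) (v : V) (j : ℕ) :
    (later G φ i v).testBit j = true ↔ i < j ∧ j < 14 ∧ G.Adj v (φ j) := by
  unfold later
  by_cases hj : j < 14
  · rw [Nat.testBit_ofBits_lt _ _ hj]
    simp [hj]
  · rw [Nat.testBit_ofBits_ge _ _ (by omega)]
    simp [hj]

theorem later_congr {G : SimpleGraph V} {φ ψ : ℕ → V} {i : ℕ} (h : ∀ j, i < j → φ j = ψ j) (v : V) :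
    later G φ i v = later G ψ i v := by
  apply Nat.eq_of_testBit_eq
  intro j
  rw [Bool.eq_iff_iff, testBit_later, testBit_later]
  constructor
  · rintro ⟨h1, h2, h3⟩; exact ⟨h1, h2, h j h1 ▸ h3⟩
  · rintro ⟨h1, h2, h3⟩; exact ⟨h1, h2, (h j h1).symm ▸ h3⟩

open Classical in
/-- The set of neighbours of `v`. -/
noncomputable def nbhd [Fintype V] (G : SimpleGraph V) (v : V) : Finset V :=
  univ.filter fun w => G.Adj v w

theorem mem_nbhd [Fintype V] {G : SimpleGraph V} {v w : V} : w ∈ nbhd G v ↔ G.Adj v w := by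
  simp [nbhd]

open Classical in
/-- Twice the number of triangles through `v`. -/
noncomputable def triangles [Fintype V] (G : SimpleGraph V) (v : V) : ℕ :=
  ∑ w ∈ nbhd G v, (nbhd G w ∩ nbhd G v).card

/-- A lexicographic breadth-first order `φ 13, φ 12, …, φ off` of all vertices: the vertex taken
next is one whose set of neighbours among the vertices already taken is lexicographically largest,
with ties resolved in favour of large degree. The first vertex has the maximum degree and, among
those, lies on the fewest triangles. -/
structure LexOrder [Fintype V] (G : SimpleGraph V) (φ : ℕ → V) (off : ℕ) : Prop where
  inj : Set.InjOn φ (Set.Icc off 13)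
  surj : ∀ v, ∃ i ∈ Set.Icc off 13, φ i = v
  lex : ∀ i j, off ≤ j → j < i → i ≤ 13 → later G φ i (φ j) ≤ later G φ i (φ i) ∧
    (later G φ i (φ j) = later G φ i (φ i) → (nbhd G (φ j)).card ≤ (nbhd G (φ i)).card)
  root_deg : ∀ v, (nbhd G v).card ≤ (nbhd G (φ 13)).card
  root_tri : ∀ v, (nbhd G v).card = (nbhd G (φ 13)).card → triangles G (φ 13) ≤ triangles G v

theorem exists_root [Fintype V] [Nonempty V] (G : SimpleGraph V) :
    ∃ r : V, (∀ v, (nbhd G v).card ≤ (nbhd G r).card) ∧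
      ∀ v, (nbhd G v).card = (nbhd G r).card → triangles G r ≤ triangles G v := by
  obtain ⟨r, -, hr⟩ := exists_max_image (univ : Finset V)
    (fun v => toLex ((nbhd G v).card, OrderDual.toDual (triangles G v))) univ_nonempty
  refine ⟨r, fun v => ?_, fun v hv => ?_⟩
  · rcases Prod.Lex.toLex_le_toLex.1 (hr v (mem_univ v)) with h | h
    · exact h.le
    · exact h.1.le
  · rcases Prod.Lex.toLex_le_toLex.1 (hr v (mem_univ v)) with h | h
    · exact (h.ne hv).elim
    · exact h.2

theorem exists_lexOrder [Fintype V] (G : SimpleGraph V) {off : ℕ} (hoff : off ≤ 13)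
    (hV : Fintype.card V = 14 - off) : ∃ φ, LexOrder G φ off := by
  classical
  have : Nonempty V := Fintype.card_pos_iff.1 (by omega)
  obtain ⟨r, hr1, hr2⟩ := exists_root G
  suffices H : ∀ m, off + m ≤ 13 → ∃ φ : ℕ → V, φ 13 = r ∧ Set.InjOn φ (Set.Icc (13 - m) 13) ∧
      ∀ i ∈ Set.Icc (13 - m) 13, ∀ v, v ∉ φ '' Set.Icc i 13 →
        later G φ i v ≤ later G φ i (φ i) ∧
        (later G φ i v = later G φ i (φ i) → (nbhd G v).card ≤ (nbhd G (φ i)).card) by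
    obtain ⟨φ, h13, hinj, hlex⟩ := H (13 - off) (by omega)
    rw [show 13 - (13 - off) = off by omega] at hinj hlex
    refine ⟨φ, hinj, ?_, ?_, h13.symm ▸ hr1, h13.symm ▸ hr2⟩
    · have hc : ((Finset.Icc off 13).image φ).card = Fintype.card V := by
        rw [card_image_of_injOn (by simpa using hinj), hV]
        simp
      intro v
      have hv : v ∈ (Finset.Icc off 13).image φ := by
        rw [Finset.card_eq_iff_eq_univ _ |>.1 hc]
        exact mem_univ v
      obtain ⟨i, hi, rfl⟩ := mem_image.1 hv
      exact ⟨i, by simpa using hi, rfl⟩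
    · intro i j h1 h2 h3
      refine hlex i ⟨by omega, h3⟩ _ ?_
      rintro ⟨k, ⟨hk, hk'⟩, e⟩
      have := hinj ⟨by omega, hk'⟩ ⟨h1, by omega⟩ e
      omega
  intro m
  induction m with
  | zero =>
    intro _
    refine ⟨fun _ => r, rfl, ?_, ?_⟩
    · rintro i ⟨hi, hi'⟩ j ⟨hj, hj'⟩ _
      omega
    · rintro i ⟨hi, hi'⟩ v _
      have h0 : ∀ w, later G (fun _ => r) i w = 0 := by
        intro w
        apply Nat.eq_of_testBit_eq
        intro j
        rw [Bool.eq_iff_iff, testBit_later]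
        simp
        omega
      rw [h0, h0]
      exact ⟨le_rfl, fun _ => hr1 v⟩
  | succ m ih =>
    intro hm
    obtain ⟨φ, h13, hinj, hlex⟩ := ih (by omega)
    have hne : (univ \ (Finset.Icc (13 - m) 13).image φ).Nonempty := by
      rw [← card_pos, card_sdiff_of_subset (subset_univ _),
        card_image_of_injOn (by simpa using hinj),
        card_univ, hV]
      simp
      omega
    obtain ⟨u, hu, hmax⟩ := exists_max_image _
      (fun v => toLex (later G φ (12 - m) v, (nbhd G v).card)) hne
    have hu' : ∀ i, 13 - m ≤ i → i ≤ 13 → φ i ≠ u := by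
      intro i h1 h2 e
      rw [mem_sdiff] at hu
      exact hu.2 (mem_image.2 ⟨i, by simp [h1, h2], e⟩)
    have hup : ∀ i, i ≠ 12 - m → Function.update φ (12 - m) u i = φ i := fun i hi =>
      Function.update_of_ne hi _ _
    have hself : Function.update φ (12 - m) u (12 - m) = u := Function.update_self _ _ _
    refine ⟨Function.update φ (12 - m) u, by rw [hup _ (by omega), h13], ?_, ?_⟩
    · rintro i ⟨hi, hi'⟩ j ⟨hj, hj'⟩ e
      by_cases h1 : i = 12 - m <;> by_cases h2 : j = 12 - m
      · omega
      · rw [hup j h2, h1, hself] at e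
        exact (hu' j (by omega) hj' e.symm).elim
      · rw [hup i h1, h2, hself] at e
        exact (hu' i (by omega) hi' e).elim
      · rw [hup i h1, hup j h2] at e
        exact hinj ⟨by omega, hi'⟩ ⟨by omega, hj'⟩ e
    · rintro i ⟨hi, hi'⟩ v hv
      have hc : ∀ w, later G (Function.update φ (12 - m) u) i w = later G φ i w := fun w =>
        later_congr (fun j hj => hup j (by omega)) w
      rw [hc, hc]
      by_cases h1 : i = 12 - m
      · subst h1
        rw [hself]
        have hvU : v ∈ univ \ (Finset.Icc (13 - m) 13).image φ := by
          rw [mem_sdiff]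
          refine ⟨mem_univ v, fun h => hv ?_⟩
          obtain ⟨j, hj, rfl⟩ := mem_image.1 h
          rw [Finset.mem_Icc] at hj
          exact ⟨j, ⟨by omega, hj.2⟩, hup j (by omega)⟩
        rcases Prod.Lex.toLex_le_toLex.1 (hmax v hvU) with h | h
        · exact ⟨h.le, fun e => (h.ne e).elim⟩
        · exact ⟨h.1.le, fun _ => h.2⟩
      · rw [hup i h1]
        refine hlex i ⟨by omega, hi'⟩ v ?_
        rintro ⟨j, ⟨hj, hj'⟩, rfl⟩
        exact hv ⟨j, ⟨hj, hj'⟩, hup j (by omega)⟩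

theorem IsCode.zero (G : SimpleGraph V) (φ : ℕ → V) : IsCode G φ (Set.Icc 13 13) 0 := by
  refine ⟨?_, ?_, ?_⟩
  · rintro i ⟨hi, hi'⟩ j ⟨hj, hj'⟩ _
    omega
  · rintro i ⟨hi, hi'⟩
    omega
  · intro i j
    rw [testBit_row]
    simp only [Nat.zero_testBit, Bool.and_false, Bool.false_eq_true, false_iff]
    rintro ⟨⟨hi, hi'⟩, ⟨hj, hj'⟩, h⟩
    have : i = j := by omega
    exact G.loopless.irrefl _ (this ▸ h)

theorem salt_lt (A M : ℕ) : salt A M < 2 ^ 32 := by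
  change _ % 2147483647 < _
  exact (Nat.mod_lt _ (by norm_num)).trans (by norm_num)

theorem testBit_addVertex {A p M i j : ℕ} (hM : M < 2 ^ 16) (hp : p < 16) (hj : j < 16) :
    (row (addVertex A p M) i).testBit j = true ↔
      (row A i).testBit j = true ∨ (i = p ∧ M.testBit j = true) ∨ (M.testBit i = true ∧ j = p) := by
  have e : 16 * i + 32 + j = 32 + (16 * i + j) := by ring
  rw [testBit_row, testBit_row]
  simp only [hj, decide_true, Bool.true_and]
  change (((A >>> 32) ||| ((M <<< (16 * p)) |||
    (orBits (fun w => bit (Nat.add (Nat.mul 16 w) p)) M))) <<< 32 ||| salt A M).testBit _ = true ↔ _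
  have hs : (salt A M).testBit (16 * i + 32 + j) = false :=
    Nat.testBit_lt_two_pow ((salt_lt A M).trans_le (Nat.pow_le_pow_right (by norm_num) (by omega)))
  rw [Nat.testBit_or, hs, Bool.or_false, Nat.testBit_shiftLeft, e]
  have : 32 + (16 * i + j) ≥ 32 := by omega
  rw [decide_eq_true this, Bool.true_and, Nat.add_sub_cancel_left, Nat.testBit_or, Nat.testBit_or,
    Nat.testBit_shiftRight, Nat.testBit_shiftLeft, Bool.or_eq_true, Bool.or_eq_true,
    testBit_orBits _ hM]
  refine or_congr_right (or_congr ?_ ?_)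
  · rw [Bool.and_eq_true, decide_eq_true_iff]
    constructor
    · rintro ⟨h1, h2⟩
      have := bit_lt_of_lt hM h2
      have : i = p := by omega
      subst this
      rw [Nat.add_sub_cancel_left] at h2
      exact ⟨rfl, h2⟩
    · rintro ⟨rfl, h⟩
      rw [Nat.add_sub_cancel_left]
      exact ⟨by omega, h⟩
  · constructor
    · rintro ⟨w, hw, h⟩
      rw [testBit_bit, decide_eq_true_iff] at h
      change 16 * w + p = 16 * i + j at h
      have : w = i := by omega
      subst this
      exact ⟨(mem_ones.1 hw).2, by omega⟩
    · rintro ⟨h1, rfl⟩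
      refine ⟨i, mem_ones.2 ⟨bit_lt_of_lt hM h1, h1⟩, ?_⟩
      rw [testBit_bit, decide_eq_true_iff]
      rfl

theorem IsCode.addVertex {G : SimpleGraph V} {φ : ℕ → V} {L : Set ℕ} {A p M : ℕ}
    (hA : IsCode G φ L A) (hp : p < 16) (hpL : ∀ i ∈ L, φ i ≠ φ p)
    (hM : ∀ i, M.testBit i = true ↔ i ∈ L ∧ G.Adj (φ p) (φ i)) :
    IsCode G φ (insert p L) (addVertex A p M) := by
  have hM16 : M < 2 ^ 16 := lt_two_pow_of_bits fun i hi => hA.lt i ((hM i).1 hi).1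
  have hlt : ∀ i ∈ insert p L, i < 16 := by
    rintro i (rfl | hi)
    exacts [hp, hA.lt i hi]
  refine ⟨?_, hlt, ?_⟩
  · rintro i (rfl | hi) j (rfl | hj) e
    · rfl
    · exact (hpL j hj e.symm).elim
    · exact (hpL i hi e).elim
    · exact hA.inj hi hj e
  · intro i j
    have hpn : p ∉ L := fun h => hpL p h rfl
    by_cases hj : j < 16
    · rw [testBit_addVertex hM16 hp hj, hA.row_iff, hM, hM]
      constructor
      · rintro (⟨h1, h2, h3⟩ | ⟨rfl, h1, h2⟩ | ⟨⟨h1, h2⟩, rfl⟩)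
        · exact ⟨Or.inr h1, Or.inr h2, h3⟩
        · exact ⟨Or.inl rfl, Or.inr h1, h2⟩
        · exact ⟨Or.inr h1, Or.inl rfl, h2.symm⟩
      · rintro ⟨rfl | h1, rfl | h2, h3⟩
        · exact (G.loopless.irrefl _ h3).elim
        · exact Or.inr (Or.inl ⟨rfl, h2, h3⟩)
        · exact Or.inr (Or.inr ⟨⟨h1, h3.symm⟩, rfl⟩)
        · exact Or.inl ⟨h1, h2, h3⟩
    · constructor
      · intro h; exact (hj (row_testBit_lt h)).elim
      · rintro ⟨-, h, -⟩; exact (hj (hlt j h)).elim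

/-- Among the sets enumerated by `subsets` is every set `M` that contains no two elements near each
other. -/
theorem subsets_sound {A col sh : ℕ} {ok : ℕ → Bool} {M : ℕ} (hcol : M >>> sh ≤ col)
    (hnear : ∀ b c, M.testBit b = true → M.testBit c = true → b ≠ c →
      ¬ (near A b).testBit c = true) :
    ∀ fuel M' X, subsets A col sh ok fuel M' X = true →
      (∀ i, M'.testBit i = true → M.testBit i = true) →
      (∀ i, M.testBit i = true → M'.testBit i = true ∨ X.testBit i = true) → ok M = true := by
  intro fuel
  induction fuel with
  | zero => intro M' X h; cases h
  | succ fuel ih =>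
    intro M' X h h1 h2
    change force M' (fun M =>
      sel (Nat.blt col (Nat.shiftRight M sh)) true <|
      force X fun X =>
      sel (Nat.beq X 0) (ok M) <|
      force (Nat.log2 X) fun b => force (Nat.xor X (bit b)) fun X =>
        sel (subsets A col sh ok fuel (Nat.lor M (bit b)) (diff X (near A b)))
          (subsets A col sh ok fuel M X) false) = true at h
    simp only [force_eq, sel_true_left] at h
    rcases h with h | h
    · have hle : M' ≤ M := by
        have : M' &&& M = M' := by
          apply Nat.eq_of_testBit_eq
          intro i
          rw [Nat.testBit_and]
          cases hi : M'.testBit i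
          · rfl
          · rw [h1 i hi]; rfl
        rw [← this]
        exact Nat.and_le_right
      have h3 : col < M' >>> sh := Nat.le_of_ble_eq_true h
      have h4 : M' >>> sh ≤ M >>> sh := by
        rw [Nat.shiftRight_eq_div_pow, Nat.shiftRight_eq_div_pow]
        exact Nat.div_le_div_right hle
      omega
    · by_cases hX : X = 0
      · subst hX
        have : M' = M := by
          apply Nat.eq_of_testBit_eq
          intro i
          rw [Bool.eq_iff_iff]
          exact ⟨h1 i, fun hi => (h2 i hi).resolve_right (by simp)⟩
        rw [← this]
        exact h
      · rw [sel_eq, if_neg (by simpa using hX), sel_false_right] at h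
        have hl := Nat.testBit_log2 hX
        generalize Nat.log2 X = b at hl h
        have hxor : ∀ i, (Nat.xor X (bit b)).testBit i = true ↔ X.testBit i = true ∧ i ≠ b := by
          intro i
          change (X ^^^ bit b).testBit i = true ↔ _
          rw [Nat.testBit_xor, testBit_bit]
          by_cases hi : b = i
          · subst hi; rw [hl]; simp
          · rw [decide_eq_false hi, Bool.xor_false]
            exact ⟨fun h => ⟨h, Ne.symm hi⟩, fun h => h.1⟩
        have hor : ∀ i, (Nat.lor M' (bit b)).testBit i = true ↔ M'.testBit i = true ∨ i = b := by
          intro i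
          change (M' ||| bit b).testBit i = true ↔ _
          rw [Nat.testBit_or, testBit_bit, Bool.or_eq_true, decide_eq_true_iff, eq_comm (a := b)]
        by_cases hb : M.testBit b = true
        · refine ih _ _ h.1 ?_ ?_
          · intro i hi
            rcases (hor i).1 hi with hi | rfl
            exacts [h1 i hi, hb]
          · intro i hi
            rw [hor, testBit_diff, Bool.and_eq_true, hxor]
            by_cases hib : i = b
            · exact Or.inl (Or.inr hib)
            · rcases h2 i hi with h3 | h3
              · exact Or.inl (Or.inl h3)
              · refine Or.inr ⟨⟨h3, hib⟩, ?_⟩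
                have := hnear b i hb hi (Ne.symm hib)
                simpa using this
        · refine ih _ _ h.2 h1 ?_
          intro i hi
          rw [hxor]
          rcases h2 i hi with h3 | h3
          · exact Or.inl h3
          · exact Or.inr ⟨h3, fun e => hb (e ▸ hi)⟩

/-! ### Correctness of the search -/

/-- The vertices at the positions `q, …, 13` of a lexicographic breadth-first order have been found,
and `A` stores the graph induced on them. -/
structure SearchState [Fintype V] (G : SimpleGraph V) (φ : ℕ → V) (off q A : ℕ) : Prop where
  order : LexOrder G φ off
  code : IsCode G φ (Set.Icc q 13) A
  off_le : off ≤ q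
  le_last : q ≤ 13

namespace SearchState

variable [Fintype V] {G : SimpleGraph V} {φ : ℕ → V} {off q A : ℕ}

theorem row_lt (h : SearchState G φ off q A) (i : ℕ) : row A i < 2 ^ 14 := by
  refine lt_two_pow_of_bits fun j hj => ?_
  have := ((h.code.row_iff i j).1 hj).2.1.2
  omega

theorem mem_ones_row (h : SearchState G φ off q A) {i j : ℕ} :
    j ∈ ones (row A i) ↔ i ∈ Set.Icc q 13 ∧ j ∈ Set.Icc q 13 ∧ G.Adj (φ i) (φ j) := by
  rw [mem_ones_of_lt (h.row_lt i) (by norm_num), h.code.row_iff]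

/-- All neighbours of the vertex at position `i` have been found. -/
def Complete (G : SimpleGraph V) (φ : ℕ → V) (off q i : ℕ) : Prop :=
  ∀ k, off ≤ k → k < q → ¬ G.Adj (φ k) (φ i)

section

variable [DecidableEq V]

theorem deg_eq_card (h : SearchState G φ off q A) (i : ℕ) :
    deg A i = ((ones (row A i)).image φ).card := by
  rw [card_image_of_injOn (h.code.inj.mono fun j hj => (h.mem_ones_row.1 hj).2.1)]
  exact popCount_eq (h.row_lt i)

theorem image_row_subset (h : SearchState G φ off q A) (i : ℕ) :
    (ones (row A i)).image φ ⊆ nbhd G (φ i) := by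
  intro v hv
  obtain ⟨j, hj, rfl⟩ := mem_image.1 hv
  exact mem_nbhd.2 (h.mem_ones_row.1 hj).2.2

theorem image_row_eq (h : SearchState G φ off q A) {i : ℕ} (hi : i ∈ Set.Icc q 13)
    (hc : Complete G φ off q i) : (ones (row A i)).image φ = nbhd G (φ i) := by
  refine (h.image_row_subset i).antisymm fun v hv => ?_
  obtain ⟨k, ⟨hk, hk'⟩, rfl⟩ := h.order.surj v
  rw [mem_nbhd] at hv
  have hqk : q ≤ k := by
    by_contra hlt
    exact hc k hk (by omega) hv.symm
  exact mem_image_of_mem φ (h.mem_ones_row.2 ⟨hi, ⟨hqk, hk'⟩, hv⟩)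

end

theorem deg_lt (h : SearchState G φ off q A) {i p : ℕ} (hp : off ≤ p) (hpq : p < q)
    (hadj : G.Adj (φ i) (φ p)) : deg A i < (nbhd G (φ i)).card := by
  classical
  rw [h.deg_eq_card]
  refine card_lt_card ⟨h.image_row_subset i, fun hs => ?_⟩
  obtain ⟨j, hj, e⟩ := mem_image.1 (hs (mem_nbhd.2 hadj))
  obtain ⟨-, ⟨h1, h2⟩, -⟩ := h.mem_ones_row.1 hj
  have := h.order.inj ⟨h.off_le.trans h1, h2⟩ ⟨hp, by omega⟩ e
  omega

theorem deg_eq (h : SearchState G φ off q A) {i : ℕ} (hi : i ∈ Set.Icc q 13)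
    (hc : Complete G φ off q i) : deg A i = (nbhd G (φ i)).card := by
  classical
  rw [h.deg_eq_card, h.image_row_eq hi hc]

/-- A vertex that already has its full degree has no further neighbours. -/
theorem complete_of_deg_eq (h : SearchState G φ off q A) {i : ℕ}
    (hd : (nbhd G (φ i)).card ≤ deg A i) : Complete G φ off q i := by
  intro k h1 h2 hadj
  have := h.deg_lt h1 h2 hadj.symm
  omega

theorem tri_eq (h : SearchState G φ off q A) {i : ℕ} (hi : i ∈ Set.Icc q 13)
    (hc : Complete G φ off q i) : tri A i = triangles G (φ i) := by
  classical
  unfold tri triangles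
  rw [sumBits_eq _ ((h.row_lt i).trans (by norm_num)), ← h.image_row_eq hi hc,
    sum_image (h.code.inj.mono fun j hj => (h.mem_ones_row.1 hj).2.1)]
  refine sum_congr rfl fun p hp => ?_
  have hb : ∀ j, (Nat.land (row A p) (row A i)).testBit j = true ↔
      (row A p).testBit j = true ∧ (row A i).testBit j = true := by
    intro j
    change (row A p &&& row A i).testBit j = true ↔ _
    rw [Nat.testBit_and, Bool.and_eq_true]
  have hlt : Nat.land (row A p) (row A i) < 2 ^ 14 :=
    lt_two_pow_of_bits fun j hj => bit_lt_of_lt (h.row_lt i) ((hb j).1 hj).2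
  rw [popCount_eq hlt, ← card_image_of_injOn (f := φ) (h.code.inj.mono fun j hj =>
    ((h.code.row_iff i j).1 ((hb j).1 (mem_ones.1 hj).2).2).2.1)]
  congr 1
  ext v
  rw [mem_inter, mem_image, mem_image]
  constructor
  · rintro ⟨j, hj, rfl⟩
    obtain ⟨h1, h2⟩ := (hb j).1 (mem_ones.1 hj).2
    refine ⟨mem_nbhd.2 ((h.code.row_iff p j).1 h1).2.2, j, ?_, rfl⟩
    exact h.mem_ones_row.2 ((h.code.row_iff i j).1 h2)
  · rintro ⟨h1, j, h2, rfl⟩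
    refine ⟨j, ?_, rfl⟩
    have h3 := h.mem_ones_row.1 h2
    have h4 := h.mem_ones_row.1 hp
    rw [mem_ones_of_lt hlt (by norm_num), hb, h.code.row_iff, h.code.row_iff]
    exact ⟨⟨h4.2.1, h3.2.1, mem_nbhd.1 h1⟩, h3⟩

end SearchState

/-- The neighbours of the next vertex among those already found. -/
noncomputable def nextMask (G : SimpleGraph V) (φ : ℕ → V) (p : ℕ) : ℕ := later G φ p (φ p)

theorem testBit_nextMask (G : SimpleGraph V) (φ : ℕ → V) (p j : ℕ) :
    (nextMask G φ p).testBit j = true ↔ j ∈ Set.Icc (p + 1) 13 ∧ G.Adj (φ p) (φ j) := by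
  rw [nextMask, testBit_later, Set.mem_Icc]
  constructor
  · rintro ⟨h1, h2, h3⟩; exact ⟨⟨h1, by omega⟩, h3⟩
  · rintro ⟨⟨h1, h2⟩, h3⟩; exact ⟨h1, by omega, h3⟩

theorem nextMask_lt (G : SimpleGraph V) (φ : ℕ → V) (p : ℕ) : nextMask G φ p < 2 ^ 14 :=
  lt_two_pow_of_bits fun j hj => by
    have := ((testBit_nextMask G φ p j).1 hj).1.2
    omega

namespace SearchState

variable [Fintype V] {G : SimpleGraph V} {φ : ℕ → V} {off p A : ℕ}

/-- The vertices not yet found have lexicographically smaller sets of neighbours than the next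
one. -/
theorem complete_of_lt (h : SearchState G φ off (p + 1) A) {j : ℕ} (hj : j ∈ Set.Icc (p + 1) 13)
    (hM : nextMask G φ p < 2 ^ j) : Complete G φ off (p + 1) j := by
  intro k hk hkp hadj
  have hle : later G φ p (φ k) ≤ nextMask G φ p := by
    rcases Nat.lt_succ_iff_lt_or_eq.1 hkp with h1 | rfl
    · exact (h.order.lex p k hk h1 (by have := h.le_last; omega)).1
    · exact le_rfl
  have hb : (later G φ p (φ k)).testBit j = true :=
    (testBit_later _ _ _ _ _).2 ⟨hj.1, by have := hj.2; omega, hadj⟩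
  exact absurd (bit_lt_of_lt (hle.trans_lt hM) hb) (lt_irrefl _)

/-- The vertices not yet found are not adjacent to those at the positions `v, …, 13`, so that sparse
sets among the former and the latter can be combined. -/
theorem blocked_sound (h : SearchState G φ off (p + 1) A) {F need v : ℕ}
    (hF : ∀ x, TableValid G F x) (hv : v ∈ Set.Icc (p + 1) 13) (hM : nextMask G φ p < 2 ^ v)
    (hb : blocked A F need (Nat.sub (p + 1) off) (p + 1) v = true) :
    ∃ S, Sparse G S ∧ S.card = need + 1 := by
  classical
  set E : Finset V := (Finset.Icc off p).image φ with hE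
  have hEc : E.card = Nat.sub (p + 1) off := by
    rw [hE, card_image_of_injOn]
    · rw [Nat.card_Icc]; rfl
    · refine h.order.inj.mono ?_
      intro i hi
      simp only [coe_Icc, Set.mem_Icc] at hi ⊢
      have := h.le_last
      omega
  have hEL : ∀ e ∈ E, ∀ i ∈ Set.Icc (p + 1) 13, e ≠ φ i := by
    rintro e he i ⟨hi, hi'⟩ rfl
    obtain ⟨k, hk, e⟩ := mem_image.1 he
    rw [Finset.mem_Icc] at hk
    have := h.order.inj ⟨hk.1, by omega⟩ ⟨by have := h.off_le; omega, hi'⟩ e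
    omega
  have hz : ∀ i, (diff (Nat.sub (bit v) (bit (p + 1))) (row A v)).testBit i = true ↔
      (p + 1 ≤ i ∧ i < v) ∧ ¬ (row A v).testBit i = true := by
    intro i
    rw [testBit_diff, Bool.and_eq_true, testBit_bit_sub_bit hv.1]
    simp
  have hv1 := hv.1
  have hv2 := hv.2
  have hc : ∀ i, (used (Nat.succ v)).testBit i = true ↔ v + 1 ≤ i ∧ i < 14 := by
    intro i
    exact testBit_used (q := v + 1) (by omega) i
  unfold blocked at hb
  rw [← hEc] at hb
  refine through_sound h.code hv (hF _) hEL ?_ ?_ ?_ ?_ hb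
  · intro i hi
    rw [hc] at hi
    exact ⟨⟨by omega, by omega⟩, by omega⟩
  · intro i hi
    obtain ⟨h1, h2⟩ := (hz i).1 hi
    have hiL : i ∈ Set.Icc (p + 1) 13 := ⟨h1.1, by omega⟩
    refine ⟨hiL, by omega, by omega, fun e => h2 ((h.code.row_iff v i).2 ⟨hv, hiL, e.symm⟩)⟩
  · intro i hi hi'
    rw [hc] at hi
    have := ((hz i).1 hi').1
    omega
  · intro e he i hi
    obtain ⟨k, hk, rfl⟩ := mem_image.1 he
    rw [Finset.mem_Icc] at hk
    have hi' : v ≤ i ∧ i ≤ 13 := by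
      rcases hi with hi | rfl
      · rw [hc] at hi; omega
      · omega
    refine h.complete_of_lt ⟨by omega, hi'.2⟩ (hM.trans_le ?_) k hk.1 (by omega)
    exact Nat.pow_le_pow_right (by norm_num) hi'.1

theorem tieFail_exists {i : ℕ} : ∀ n, tieFail A i n = true → ∃ k, i < k ∧ k ≤ i + n ∧
    row A i >>> (k + 1) = row A k >>> (k + 1) ∧ deg A k ≤ deg A i := by
  intro n
  induction n with
  | zero => intro h; cases h
  | succ n ih =>
    intro h
    change sel (Nat.beq (row A i >>> (i + n + 2)) (row A (i + n + 1) >>> (i + n + 2)))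
      (sel (Nat.ble (deg A (i + n + 1)) (deg A i)) true (tieFail A i n)) (tieFail A i n) = true at h
    rw [sel_eq] at h
    split_ifs at h with h1
    · rcases sel_true_left.1 h with h2 | h2
      · exact ⟨i + n + 1, by omega, by omega, Nat.eq_of_beq_eq_true h1, Nat.le_of_ble_eq_true h2⟩
      · obtain ⟨k, h3, h4, h5⟩ := ih h2
        exact ⟨k, h3, by omega, h5⟩
    · obtain ⟨k, h3, h4, h5⟩ := ih h
      exact ⟨k, h3, by omega, h5⟩

/-- If the next vertex is a neighbour of the vertex `i`, and of none before it, then the degrees of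
the vertices before `i` are final, while `i` has a larger degree than so far. So none of the
former that was tied with `i` can have a degree at most the present one of `i`. -/
theorem tieFail_sound (h : SearchState G φ off (p + 1) A) (hp : off ≤ p) {i : ℕ}
    (hi : i ∈ Set.Icc (p + 1) 13) (hM : nextMask G φ p < 2 ^ (i + 1))
    (hadj : G.Adj (φ p) (φ i)) : ¬ tieFail A i (Nat.sub 13 i) = true := by
  intro ht
  obtain ⟨k, h1, h2, h3, h4⟩ := tieFail_exists _ ht
  have hi1 := hi.1
  have hi2 := hi.2
  have h2 : k ≤ 13 := by
    change k ≤ i + (13 - i) at h2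
    omega
  have hk : k ∈ Set.Icc (p + 1) 13 := ⟨by omega, h2⟩
  have hlater : later G φ k (φ i) = later G φ k (φ k) := by
    apply Nat.eq_of_testBit_eq
    intro j
    rw [Bool.eq_iff_iff, testBit_later, testBit_later]
    refine and_congr_right fun hkj => and_congr_right fun hj => ?_
    have hjL : j ∈ Set.Icc (p + 1) 13 := ⟨by omega, by omega⟩
    have := congrArg (fun x => x.testBit (j - (k + 1))) h3
    simp only [Nat.testBit_shiftRight, show k + 1 + (j - (k + 1)) = j by omega] at this
    rw [Bool.eq_iff_iff, h.code.row_iff, h.code.row_iff] at this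
    exact ⟨fun e => (this.1 ⟨hi, hjL, e⟩).2.2, fun e => (this.2 ⟨hk, hjL, e⟩).2.2⟩
  have hle := (h.order.lex k i (by have := h.off_le; omega) h1 h2).2 hlater
  have hc := h.deg_eq hk (h.complete_of_lt hk (hM.trans_le
    (Nat.pow_le_pow_right (by norm_num) h1)))
  have := h.deg_lt hp (Nat.lt_succ_self p) hadj.symm
  omega

/-- The true set of neighbours of the next vertex is among the sets enumerated by `top`. -/
theorem top_sound (h : SearchState G φ off (p + 1) A) (hp : off ≤ p) (hG : NoFourFiveCycle G)
    {ok : ℕ → Bool} {i : ℕ} (hi : i ∈ Set.Icc (p + 1) 13)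
    (hM : nextMask G φ p < 2 ^ (i + 1)) (hadj : G.Adj (φ p) (φ i))
    (ht : top A (p + 1) ok i = true) : ok (nextMask G φ p) = true := by
  have hi1 := hi.1
  have hi2 := hi.2
  have hMi : (nextMask G φ p).testBit i = true := (testBit_nextMask _ _ _ _).2 ⟨hi, hadj⟩
  have hcol : nextMask G φ p >>> (p + 1 + 1) ≤ row A (p + 1) >>> (p + 1 + 1) := by
    have e1 : nextMask G φ p >>> (p + 1 + 1) = later G φ (p + 1) (φ p) >>> (p + 1 + 1) := by
      apply Nat.eq_of_testBit_eq
      intro j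
      rw [Nat.testBit_shiftRight, Nat.testBit_shiftRight, Bool.eq_iff_iff, testBit_nextMask,
        testBit_later, Set.mem_Icc]
      constructor
      · rintro ⟨h1, h2⟩; exact ⟨by omega, by omega, h2⟩
      · rintro ⟨h1, h2, h3⟩; exact ⟨by omega, h3⟩
    have e2 : row A (p + 1) >>> (p + 1 + 1) = later G φ (p + 1) (φ (p + 1)) >>> (p + 1 + 1) := by
      apply Nat.eq_of_testBit_eq
      intro j
      rw [Nat.testBit_shiftRight, Nat.testBit_shiftRight, Bool.eq_iff_iff, h.code.row_iff,
        testBit_later, Set.mem_Icc, Set.mem_Icc]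
      constructor
      · rintro ⟨h1, h2, h3⟩; exact ⟨by omega, by omega, h3⟩
      · rintro ⟨h1, h2, h3⟩; exact ⟨by omega, by omega, h3⟩
    rw [e1, e2, Nat.shiftRight_eq_div_pow, Nat.shiftRight_eq_div_pow]
    exact Nat.div_le_div_right (h.order.lex (p + 1) p hp (Nat.lt_succ_self p) h.le_last).1
  have hcomplete : ∀ j, i < j → j ≤ 13 → Complete G φ off (p + 1) j := fun j h1 h2 =>
    h.complete_of_lt ⟨by omega, h2⟩ (hM.trans_le (Nat.pow_le_pow_right (by norm_num) h1))
  have hdeg : ∀ w, i < 13 → (nextMask G φ p).testBit w = true → deg A w < deg A 13 := by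
    intro w h13 hw
    have h1 := h.deg_lt hp (Nat.lt_succ_self p) ((testBit_nextMask _ _ _ _).1 hw).2.symm
    have h2 := h.deg_eq ⟨h.le_last, le_rfl⟩ (hcomplete 13 h13 le_rfl)
    have := h.order.root_deg (φ w)
    omega
  have hx : ∀ j ∈ Set.Icc (p + 1) 13, φ p ≠ φ j := by
    rintro j ⟨h1, h2⟩ e
    have := h.order.inj ⟨hp, by have := h.le_last; omega⟩ ⟨by omega, h2⟩ e
    omega
  have hnear : ∀ b c, (nextMask G φ p).testBit b = true → (nextMask G φ p).testBit c = true →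
      b ≠ c → ¬ (near A b).testBit c = true := by
    intro b c hb hc hbc
    rw [testBit_nextMask] at hb hc
    exact near_sound hG h.code hx hbc hb.1 hc.1 hb.2 hc.2
  unfold top at ht
  simp only [sel_true_left] at ht
  rcases ht with ht | ht
  · have h1 : row A (p + 1) >>> (p + 1 + 1) < bit i >>> (p + 1 + 1) := Nat.le_of_ble_eq_true ht
    have h2 : bit i >>> (p + 1 + 1) ≤ nextMask G φ p >>> (p + 1 + 1) := by
      rw [Nat.shiftRight_eq_div_pow, Nat.shiftRight_eq_div_pow]
      apply Nat.div_le_div_right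
      change 1 <<< i ≤ _
      rw [Nat.one_shiftLeft]
      exact Nat.ge_two_pow_of_testBit hMi
    omega
  · rw [sel_eq, if_pos] at ht
    · have ht := (sel_true_left.1 ht).resolve_left (h.tieFail_sound hp hi hM hadj)
      refine subsets_sound hcol hnear _ _ _ ht ?_ ?_
      · intro j hj
        rw [testBit_bit, decide_eq_true_iff] at hj
        exact hj ▸ hMi
      · intro j hj
        have hjM := (testBit_nextMask _ _ _ _).1 hj
        have hji : j < i + 1 := bit_lt_of_lt hM hj
        rw [testBit_bit, decide_eq_true_iff]
        by_cases hij : i = j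
        · exact Or.inl hij
        · right
          rw [testBit_diff, Bool.and_eq_true]
          refine ⟨?_, by simpa using hnear i j hMi hj hij⟩
          change (_ &&& (bit i - 1)).testBit j = true
          rw [Nat.testBit_and, Bool.and_eq_true]
          constructor
          · rw [sel_eq]
            split_ifs with h13
            · rw [testBit_used (by have := h.le_last; omega)]
              exact ⟨hjM.1.1, by have := hjM.1.2; omega⟩
            · have h13' : i < 13 := by
                have : i ≠ 13 := fun e => h13 (by rw [e]; rfl)
                omega
              unfold notFull
              rw [testBit_orBits]
              · refine ⟨j, ?_, ?_⟩
                · rw [mem_ones, testBit_used (by have := h.le_last; omega)]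
                  have := hjM.1.1
                  have := hjM.1.2
                  omega
                · have hlt : Nat.blt (deg A j) (deg A 13) = true :=
                    Nat.ble_eq_true_of_le (hdeg j h13' hj)
                  rw [hlt]
                  change (bit j).testBit j = true
                  rw [testBit_bit, decide_eq_true rfl]
              · refine lt_two_pow_of_bits fun k hk => ?_
                rw [testBit_used (by have := h.le_last; omega)] at hk
                omega
          · change (1 <<< i - 1).testBit j = true
            rw [Nat.one_shiftLeft, Nat.testBit_two_pow_sub_one, decide_eq_true_iff]
            omega
    · rw [sel_true_left]
      by_cases h13 : i = 13
      · left; rw [h13]; rfl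
      · right
        exact Nat.ble_eq_true_of_le (hdeg i (by omega) hMi)

/-- The true set of neighbours of the next vertex is among the sets enumerated by `tops`, unless
there is a sparse set of `need + 1` vertices. -/
theorem tops_sound (h : SearchState G φ off (p + 1) A) (hp : off ≤ p) (hG : NoFourFiveCycle G)
    {F need : ℕ} (hF : ∀ x, TableValid G F x) (hS : ¬ ∃ S, Sparse G S ∧ S.card = need + 1)
    {ok : ℕ → Bool} : ∀ n, p + 1 + n ≤ 14 → nextMask G φ p < 2 ^ (p + 1 + n) →
      tops A F need off (p + 1) ok n = true → ok (nextMask G φ p) = true := by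
  have hlast := h.le_last
  intro n
  induction n with
  | zero =>
    intro _ hM ht
    have hM0 : nextMask G φ p = 0 := by
      apply Nat.eq_of_testBit_eq
      intro j
      rw [Nat.zero_testBit, ← Bool.not_eq_true]
      intro hj
      have := bit_lt_of_lt hM hj
      have := ((testBit_nextMask _ _ _ _).1 hj).1.1
      omega
    rcases sel_true_left.1 ht with ht | ht
    · refine (hS (h.blocked_sound hF ⟨le_rfl, hlast⟩ ?_ ht)).elim
      rw [hM0]; positivity
    · rw [hM0]; exact ht
  | succ n ih =>
    intro hn hM ht
    change force (p + 1 + n) (fun i =>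
      sel (sel (Nat.blt i (Nat.log2 (row A (p + 1))))
        (blocked A F need (Nat.sub (p + 1) off) (p + 1) (Nat.succ i)) false) true
      (sel (top A (p + 1) ok i) (tops A F need off (p + 1) ok n) false)) = true at ht
    simp only [force_eq, sel_true_left, sel_false_right] at ht
    rcases ht with ⟨h1, h2⟩ | ⟨h1, h2⟩
    · refine (hS (h.blocked_sound hF ⟨by omega, ?_⟩ hM h2)).elim
      have h3 : p + 1 + n < Nat.log2 (row A (p + 1)) := Nat.le_of_ble_eq_true h1
      have h4 : row A (p + 1) ≠ 0 := by
        intro h0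
        rw [h0] at h3
        simp at h3
      have h5 := bit_lt_of_lt (h.row_lt (p + 1)) (Nat.testBit_log2 h4)
      omega
    · by_cases hb : (nextMask G φ p).testBit (p + 1 + n) = true
      · obtain ⟨hiL, hadj⟩ := (testBit_nextMask _ _ _ _).1 hb
        exact h.top_sound hp hG hiL hM hadj h1
      · refine ih (by omega) ?_ h2
        refine lt_two_pow_of_bits fun j hj => ?_
        have := bit_lt_of_lt hM hj
        have : j ≠ p + 1 + n := fun e => hb (e ▸ hj)
        omega

theorem next (h : SearchState G φ off (p + 1) A) (hp : off ≤ p) :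
    SearchState G φ off p (addVertex A p (nextMask G φ p)) := by
  have hlast := h.le_last
  refine ⟨h.order, ?_, hp, by omega⟩
  have he : Set.Icc p 13 = insert p (Set.Icc (p + 1) 13) := by
    ext i; simp only [Set.mem_insert_iff, Set.mem_Icc]; omega
  rw [he]
  refine h.code.addVertex (by omega) ?_ (testBit_nextMask G φ p)
  rintro j ⟨h1, h2⟩ e
  have := h.order.inj ⟨by omega, h2⟩ ⟨hp, by omega⟩ e
  omega

/-- When the neighbourhood of the first vertex is complete, so is that of every vertex that has the
same degree, and the numbers of triangles through them are final. -/
theorem triFail_sound (h : SearchState G φ off (p + 1) A) (hp : off ≤ p) :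
    ¬ triFail (addVertex A p (nextMask G φ p)) (nextMask G φ p) = true := by
  intro ht
  have hlast := h.le_last
  have h' := h.next hp
  unfold triFail at ht
  obtain ⟨h1, h2⟩ := sel_false_right.1 ht
  have hM : nextMask G φ p < 2 ^ 13 := Nat.le_of_ble_eq_true h1
  obtain ⟨w, hw, h3⟩ := (anyBits_iff _ ((nextMask_lt G φ p).trans (by norm_num))).1 h2
  obtain ⟨h3, h4⟩ := sel_false_right.1 h3
  have h3 := Nat.eq_of_beq_eq_true h3
  have h4 := Nat.le_of_ble_eq_true h4
  have hwL := ((testBit_nextMask _ _ _ _).1 (mem_ones.1 hw).2).1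
  have hc13 : Complete G φ off p 13 := fun k hk hkp =>
    h.complete_of_lt ⟨hlast, le_rfl⟩ hM k hk (by omega)
  have hd13 := h'.deg_eq ⟨by omega, le_rfl⟩ hc13
  have hcw : Complete G φ off p w := h'.complete_of_deg_eq (by
    have := h.order.root_deg (φ w)
    omega)
  have hwL' : w ∈ Set.Icc p 13 := ⟨by have := hwL.1; omega, hwL.2⟩
  have hdw := h'.deg_eq hwL' hcw
  rw [h'.tri_eq hwL' hcw, h'.tri_eq ⟨by omega, le_rfl⟩ hc13] at h4
  have := h.order.root_tri (φ w) (by omega)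
  omega

theorem cand_sound (h : SearchState G φ off (p + 1) A) (hp : off ≤ p) {F need : ℕ}
    (hF : ∀ x, TableValid G F x) (hS : ¬ ∃ S, Sparse G S ∧ S.card = need + 1) {nxt : ℕ → Bool}
    (ht : cand A F need p nxt (nextMask G φ p) = true) :
    nxt (addVertex A p (nextMask G φ p)) = true := by
  classical
  have hlast := h.le_last
  unfold cand at ht
  simp only [force_eq, sel_true_left] at ht
  rcases ht with ht | ht | ht
  · exact (h.triFail_sound hp ht).elim
  · refine (hS (through_sound (E := ∅) (h.next hp).code ⟨le_rfl, by omega⟩ (hF _) (by simp) ?_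
      (by simp) (by simp) (by simp) ht)).elim
    intro i hi
    rw [testBit_used (q := p + 1) (by omega)] at hi
    exact ⟨⟨by omega, by omega⟩, by omega⟩
  · exact ht

end SearchState

/-- The code of the first `m + 1` vertices of the order `φ`, as built up by the search. -/
noncomputable def orderCode (G : SimpleGraph V) (φ : ℕ → V) (m : ℕ) : ℕ :=
  Nat.rec 0 (fun k A => addVertex A (12 - k) (nextMask G φ (12 - k))) m

theorem LexOrder.searchState [Fintype V] {G : SimpleGraph V} {φ : ℕ → V} {off : ℕ}
    (hφ : LexOrder G φ off) :
    ∀ m, off + m ≤ 13 → SearchState G φ off (13 - m) (orderCode G φ m) := by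
  intro m
  induction m with
  | zero => intro h; exact ⟨hφ, IsCode.zero G φ, h, le_rfl⟩
  | succ m ih =>
    intro h
    have h1 := ih (by omega)
    rw [show 13 - m = 12 - m + 1 by omega] at h1
    rw [show 13 - (m + 1) = 12 - m by omega]
    exact h1.next (by omega)

/-- A successful search, started from the first vertices of the order `φ`, reaches the code of a
longer initial segment of `φ`. -/
theorem LexOrder.search_sound [Fintype V] {G : SimpleGraph V} {φ : ℕ → V} {off : ℕ}
    (hφ : LexOrder G φ off) (hG : NoFourFiveCycle G) {F need : ℕ} (hF : ∀ x, TableValid G F x)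
    (hS : ¬ ∃ S, Sparse G S ∧ S.card = need + 1) {leaf : ℕ → Bool} {last : ℕ} (hle : off ≤ last) :
    ∀ r, last + r ≤ 13 → search F need off last leaf r (orderCode G φ (13 - (last + r))) = true →
      leaf (orderCode G φ (13 - last)) = true := by
  intro r
  induction r with
  | zero => intro _ ht; exact ht
  | succ r ih =>
    intro hr ht
    have h := hφ.searchState (13 - (last + (r + 1))) (by omega)
    have e : 13 - (last + r) = 13 - (last + (r + 1)) + 1 := by omega
    rw [show 13 - (13 - (last + (r + 1))) = last + r + 1 by omega] at h
    generalize hm : 13 - (last + (r + 1)) = m at h ht e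
    change tops _ F need off (last + r + 1) (cand _ F need (last + r)
      (search F need off last leaf r)) (14 - (last + r + 1)) = true at ht
    have hp : off ≤ last + r := by omega
    have h1 := h.tops_sound hp hG hF hS _ (by omega)
      (by rw [show last + r + 1 + (14 - (last + r + 1)) = 14 by omega]; exact nextMask_lt G φ _) ht
    refine ih (by omega) ?_
    rw [e, show orderCode G φ (m + 1) = addVertex (orderCode G φ m) (last + r)
      (nextMask G φ (last + r)) by rw [show last + r = 12 - m by omega]; rfl]
    exact h.cand_sound hp hF hS h1

/-! ### The search for graphs on fourteen vertices -/

universe u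

theorem sel_true_right {b : Bool} {x : Bool} :
    sel b x true = true ↔ (b = true → x = true) := by
  rw [sel_eq]; cases b <;> simp

/-- Every graph on `n` vertices without cycles of length four and five has a sparse set of `j`
vertices. -/
def ForcesSparse (n j : ℕ) : Prop :=
  ∀ (V : Type u) [Fintype V] (G : SimpleGraph V), Fintype.card V = n → NoFourFiveCycle G →
    ∃ S, Sparse G S ∧ S.card = j

theorem NoFourFiveCycle.comap {V W : Type*} {G : SimpleGraph V} (hG : NoFourFiveCycle G)
    (f : W ↪ V) : NoFourFiveCycle (G.comap f) := by
  refine ⟨fun a b c d h1 h2 h3 h4 => ?_, fun a b c d e h1 h2 h3 h4 h5 n1 n2 n3 n4 n5 => ?_⟩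
  · exact (hG.four _ _ _ _ h1 h2 h3 h4).imp (fun h => f.injective h) fun h => f.injective h
  · exact hG.five _ _ _ _ _ h1 h2 h3 h4 h5 (f.injective.ne n1) (f.injective.ne n2)
      (f.injective.ne n3) (f.injective.ne n4) (f.injective.ne n5)

theorem Sparse.map {V W : Type*} {G : SimpleGraph V} {f : W ↪ V} {S : Finset W}
    (hS : Sparse (G.comap f) S) : Sparse G (S.map f) := by
  intro v hv u hu w hw e1 e2
  obtain ⟨v, hv', rfl⟩ := mem_map.1 hv
  obtain ⟨u, hu', rfl⟩ := mem_map.1 hu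
  obtain ⟨w, hw', rfl⟩ := mem_map.1 hw
  rw [hS v hv' u hu' w hw' e1 e2]

theorem ForcesSparse.exists_subset {n j : ℕ} (h : ForcesSparse.{u} n j) {V : Type u}
    {G : SimpleGraph V} (hG : NoFourFiveCycle G) {X : Finset V} (hX : n ≤ X.card) :
    ∃ S ⊆ X, Sparse G S ∧ S.card = j := by
  obtain ⟨Y, hY, hc⟩ := exists_subset_card_eq hX
  obtain ⟨S, hS, hSc⟩ := h Y (G.comap (Function.Embedding.subtype _)) (by simpa using hc)
    (hG.comap _)
  refine ⟨S.map (Function.Embedding.subtype _), ?_, hS.map, by simpa using hSc⟩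
  intro v hv
  obtain ⟨w, -, rfl⟩ := mem_map.1 hv
  exact hY w.2

theorem ForcesSparse.mono {m n j : ℕ} (h : ForcesSparse.{u} m j) (hmn : m ≤ n) :
    ForcesSparse.{u} n j := by
  intro V _ G hV hG
  obtain ⟨S, -, hS⟩ := h.exists_subset hG (X := univ) (by rw [card_univ]; omega)
  exact ⟨S, hS⟩

/-- Only the entries of the table below the number of vertices are ever consulted, so that the table
can be established entry by entry. -/
theorem tableValid_of_forcesSparse {V : Type u} [Fintype V] {G : SimpleGraph V}
    (hG : NoFourFiveCycle G) {F : ℕ} (hF : ∀ n < Fintype.card V, ForcesSparse.{u} n (bound F n))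
    (x : V) : TableValid G F x := fun _ hX =>
  (hF _ (card_lt_univ_of_notMem hX)).exists_subset hG le_rfl

/-- The bounds `0, 1, 2, 2, 3, 3, 4, 4, 5, 5, 6, 6, 6, 6, 6, 6` for the size of a sparse set among
`0, …, 15` vertices, each stored in four binary digits. -/
def table : ℕ := 7378697555895591440

theorem forcesSparse_of_search {N j : ℕ} (hN : 0 < N) (hN' : N ≤ 14)
    (hF : ∀ n < N, ForcesSparse.{u} n (bound table n))
    (h : search table j (14 - N) (14 - N) (fun _ => false) (N - 1) 0 = true) :
    ForcesSparse.{u} N (j + 1) := by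
  intro V _ G hV hG
  by_contra hS
  obtain ⟨φ, hφ⟩ := exists_lexOrder G (off := 14 - N) (by omega) (by omega)
  have := hφ.search_sound (r := N - 1) (leaf := fun _ => false) hG
    (tableValid_of_forcesSparse hG (hV ▸ hF)) hS le_rfl (by omega) (by
      rw [show 13 - (14 - N + (N - 1)) = 0 by omega]
      exact h)
  cases this

theorem forcesSparse_zero : ForcesSparse.{u} 0 0 := fun _ _ _ _ _ =>
  ⟨∅, fun v hv => by simp at hv, rfl⟩

theorem forcesSparse_one : ForcesSparse.{u} 1 1 := by
  intro V _ G hV _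
  obtain ⟨x, hx⟩ := Fintype.card_eq_one_iff.1 hV
  exact ⟨{x}, fun v _ u _ w _ _ _ => (hx u).trans (hx w).symm, rfl⟩

theorem forcesSparse_two : ForcesSparse.{u} 2 2 := by
  intro V _ G hV _
  refine ⟨univ, ?_, hV⟩
  intro v _ u _ w _ e1 e2
  by_contra h
  have : 2 < (univ : Finset V).card := two_lt_card.2 ⟨v, mem_univ _, u, mem_univ _, w, mem_univ _,
    e1.ne, e2.ne, h⟩
  rw [card_univ] at this
  omega

theorem forcesSparse_four : ForcesSparse.{u} 4 3 := by
  refine forcesSparse_of_search (j := 2) (by norm_num) (by norm_num) ?_ (by decide +kernel)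
  intro n hn
  interval_cases n
  exacts [forcesSparse_zero, forcesSparse_one, forcesSparse_two,
    forcesSparse_two.mono (by norm_num)]

theorem forcesSparse_six : ForcesSparse.{u} 6 4 := by
  refine forcesSparse_of_search (j := 3) (by norm_num) (by norm_num) ?_ (by decide +kernel)
  intro n hn
  interval_cases n
  exacts [forcesSparse_zero, forcesSparse_one, forcesSparse_two,
    forcesSparse_two.mono (by norm_num), forcesSparse_four, forcesSparse_four.mono (by norm_num)]

theorem forcesSparse_eight : ForcesSparse.{u} 8 5 := by
  refine forcesSparse_of_search (j := 4) (by norm_num) (by norm_num) ?_ (by decide +kernel)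
  intro n hn
  interval_cases n
  exacts [forcesSparse_zero, forcesSparse_one, forcesSparse_two,
    forcesSparse_two.mono (by norm_num), forcesSparse_four, forcesSparse_four.mono (by norm_num),
    forcesSparse_six, forcesSparse_six.mono (by norm_num)]

theorem forcesSparse_ten : ForcesSparse.{u} 10 6 := by
  refine forcesSparse_of_search (j := 5) (by norm_num) (by norm_num) ?_ (by decide +kernel)
  intro n hn
  interval_cases n
  exacts [forcesSparse_zero, forcesSparse_one, forcesSparse_two,
    forcesSparse_two.mono (by norm_num), forcesSparse_four, forcesSparse_four.mono (by norm_num),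
    forcesSparse_six, forcesSparse_six.mono (by norm_num), forcesSparse_eight,
    forcesSparse_eight.mono (by norm_num)]

theorem forcesSparse_table (n : ℕ) (hn : n < 14) : ForcesSparse.{u} n (bound table n) := by
  interval_cases n
  exacts [forcesSparse_zero, forcesSparse_one, forcesSparse_two,
    forcesSparse_two.mono (by norm_num), forcesSparse_four, forcesSparse_four.mono (by norm_num),
    forcesSparse_six, forcesSparse_six.mono (by norm_num), forcesSparse_eight,
    forcesSparse_eight.mono (by norm_num), forcesSparse_ten, forcesSparse_ten.mono (by norm_num),
    forcesSparse_ten.mono (by norm_num), forcesSparse_ten.mono (by norm_num)]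

/-- The adjacency matrices, one row in every sixteen binary digits, of the graphs on fourteen
vertices found by the search. -/
def leafCodes : List ℕ :=
  [3159435439168651674466627663127911790033819025477835052159945211990,
    3159435439168651674466627663127911790033814189848338784936494694490,
    3159435439162521785838912090393585700181776338008622289654399631380,
    3159435439162521739071573316928827899184960228730201797759148556294,
    3159435439162521739071573316928827898551144599395464285652918796294,
    2948800410354189998480178968339495604593656166161212412239341945184,
    2948800410354189998480178968339495604593652539439089297042039636304]

/-- Whether the adjacency matrix stored in `A` is one of `leafCodes`. -/
noncomputable def isLeaf (A : ℕ) : Bool :=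
  force (Nat.shiftRight A 32) fun B =>
    List.rec false (fun C _ ih => sel (Nat.beq B C) true ih) leafCodes

/-- The part of the search for fourteen vertices without a sparse set of eight in which the code of
the first seven vertices is congruent to `k` modulo `11`. The residue has no meaning: it serves to
divide the search into parts of moderate size. -/
noncomputable def searchPart (k : ℕ) : Bool :=
  search table 7 0 7 (fun A => sel (Nat.beq (Nat.mod A 11) k)
    (search table 7 0 0 isLeaf 7 A) true) 6 0

set_option maxHeartbeats 0 in
theorem searchPart_zero : searchPart 0 = true := by decide +kernel

set_option maxHeartbeats 0 in
theorem searchPart_one : searchPart 1 = true := by decide +kernel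

set_option maxHeartbeats 0 in
theorem searchPart_two : searchPart 2 = true := by decide +kernel

set_option maxHeartbeats 0 in
theorem searchPart_three : searchPart 3 = true := by decide +kernel

set_option maxHeartbeats 0 in
theorem searchPart_four : searchPart 4 = true := by decide +kernel

set_option maxHeartbeats 0 in
theorem searchPart_five : searchPart 5 = true := by decide +kernel

set_option maxHeartbeats 0 in
theorem searchPart_six : searchPart 6 = true := by decide +kernel

set_option maxHeartbeats 0 in
theorem searchPart_seven : searchPart 7 = true := by decide +kernel

set_option maxHeartbeats 0 in
theorem searchPart_eight : searchPart 8 = true := by decide +kernel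

set_option maxHeartbeats 0 in
theorem searchPart_nine : searchPart 9 = true := by decide +kernel

set_option maxHeartbeats 0 in
theorem searchPart_ten : searchPart 10 = true := by decide +kernel

theorem searchPart_mod (A : ℕ) : searchPart (A % 11) = true := by
  have h := Nat.mod_lt A (show 11 > 0 by norm_num)
  generalize A % 11 = k at h ⊢
  interval_cases k
  exacts [searchPart_zero, searchPart_one, searchPart_two, searchPart_three, searchPart_four,
    searchPart_five, searchPart_six, searchPart_seven, searchPart_eight, searchPart_nine,
    searchPart_ten]

theorem isLeaf_iff (A : ℕ) : isLeaf A = true ↔ A >>> 32 ∈ leafCodes := by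
  have h : ∀ (B : ℕ) (l : List ℕ),
      (List.rec false (fun C _ ih => sel (Nat.beq B C) true ih) l : Bool) = true ↔ B ∈ l := by
    intro B l
    induction l with
    | nil => simp
    | cons C l ih =>
      change sel (Nat.beq B C) true _ = true ↔ _
      rw [sel_true_left, ih, List.mem_cons, Nat.beq_eq]
  unfold isLeaf
  rw [force_eq]
  exact h (A >>> 32) leafCodes

/-- The search for fourteen vertices: the code of a graph without a sparse set of eight vertices is
one of the codes found. -/
theorem exists_code {V : Type u} [Fintype V] {G : SimpleGraph V} (hG : NoFourFiveCycle G)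
    (hV : Fintype.card V = 14) (hS : ¬ ∃ S, Sparse G S ∧ S.card = 8) :
    ∃ φ A, IsCode G φ (Set.Icc 0 13) A ∧ (∀ v, ∃ i ∈ Set.Icc 0 13, φ i = v) ∧
      A >>> 32 ∈ leafCodes := by
  obtain ⟨φ, hφ⟩ := exists_lexOrder G (off := 0) (by norm_num) hV
  have hF := tableValid_of_forcesSparse hG (hV ▸ forcesSparse_table)
  refine ⟨φ, orderCode G φ 13, (hφ.searchState 13 (by norm_num)).code, hφ.surj, ?_⟩
  have h1 := hφ.search_sound hG hF hS (last := 7) (by norm_num) 6 (by norm_num)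
    (searchPart_mod (orderCode G φ 6))
  rw [sel_true_right, Nat.beq_eq] at h1
  exact (isLeaf_iff _).1 (hφ.search_sound hG hF hS (last := 0) le_rfl 7 (by norm_num) (h1 rfl))

/-! ### Fifteen vertices, and graphs with a given adjacency matrix -/

theorem row_shift (A i : ℕ) : row ((A >>> 32) <<< 32) i = row A i := by
  apply Nat.eq_of_testBit_eq
  intro j
  rw [testBit_row, testBit_row, Nat.testBit_shiftLeft, Nat.testBit_shiftRight]
  have : 16 * i + 32 + j ≥ 32 := by omega
  rw [decide_eq_true this, Bool.true_and,
    show 32 + (16 * i + 32 + j - 32) = 16 * i + 32 + j by omega]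

/-- The low digits of a code, which only serve to spread hash values, carry no information. -/
theorem IsCode.shift {V : Type*} {G : SimpleGraph V} {φ : ℕ → V} {L : Set ℕ} {A : ℕ}
    (hA : IsCode G φ L A) : IsCode G φ L ((A >>> 32) <<< 32) :=
  ⟨hA.inj, hA.lt, fun i j => by rw [row_shift]; exact hA.row_iff i j⟩

/-- However a fifteenth vertex is joined to the graph with adjacency matrix `C` without making two
of its neighbours near each other, a sparse set of eight vertices arises. -/
noncomputable def extensionsBlocked (C : ℕ) : Bool :=
  subsets (Nat.shiftLeft C 32) 16383 0
    (fun M => through (addVertex (Nat.shiftLeft C 32) 14 M) 0 0 14 16383 0 7) 16 0 16383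

theorem extensionsBlocked_leafCodes : ∀ C ∈ leafCodes, extensionsBlocked C = true := by
  decide +kernel

theorem forcesSparse_fifteen : ForcesSparse.{u} 15 8 := by
  classical
  intro V _ G hV hG
  by_contra hS
  obtain ⟨x⟩ : Nonempty V := Fintype.card_pos_iff.1 (by omega)
  let f : {v // v ≠ x} ↪ V := Function.Embedding.subtype _
  have hW : Fintype.card {v // v ≠ x} = 14 := by
    rw [Fintype.card_subtype_compl, Fintype.card_subtype_eq, hV]
  obtain ⟨φ, A, hA, -, hleaf⟩ := exists_code (hG.comap f) hW (fun ⟨S, hs, hc⟩ =>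
    hS ⟨S.map f, hs.map, by rw [card_map, hc]⟩)
  have hblock := extensionsBlocked_leafCodes _ hleaf
  have hA := hA.shift
  generalize A >>> 32 = C at hA hblock
  let ψ : ℕ → V := fun i => if i = 14 then x else (φ i : V)
  have hψ : ∀ i ∈ Set.Icc 0 13, ψ i = φ i := by
    rintro i ⟨-, hi⟩
    exact if_neg (by omega)
  have hψx : ψ 14 = x := if_pos rfl
  have hne : ∀ i ∈ Set.Icc 0 13, x ≠ ψ i := fun i hi e => (φ i).2 ((hψ i hi).symm.trans e.symm)
  have hC : IsCode G ψ (Set.Icc 0 13) (C <<< 32) := by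
    refine ⟨fun i hi j hj e => hA.inj hi hj ?_, hA.lt, fun i j => (hA.row_iff i j).trans ?_⟩
    · rw [hψ i hi, hψ j hj] at e
      exact Subtype.ext e
    · refine and_congr_right fun hi => and_congr_right fun hj => ?_
      rw [hψ i hi, hψ j hj]
      rfl
  obtain ⟨M, hM⟩ : ∃ M : ℕ, ∀ i, M.testBit i = true ↔ i ∈ Set.Icc 0 13 ∧ G.Adj x (ψ i) := by
    refine ⟨Nat.ofBits fun j : Fin 14 => decide (G.Adj x (ψ j)), fun i => ?_⟩
    by_cases hi : i < 14
    · rw [Nat.testBit_ofBits_lt _ _ hi, decide_eq_true_iff]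
      exact ⟨fun h => ⟨⟨Nat.zero_le _, by omega⟩, h⟩, fun h => h.2⟩
    · rw [Nat.testBit_ofBits_ge _ _ (by omega)]
      simp
      omega
  have hMlt : M < 2 ^ 14 := lt_two_pow_of_bits fun i hi => by
    have := ((hM i).1 hi).1.2
    omega
  have h16383 : ∀ i, (16383 : ℕ).testBit i = true ↔ i < 14 := by
    intro i
    rw [show 16383 = 2 ^ 14 - 1 by norm_num, Nat.testBit_two_pow_sub_one, decide_eq_true_iff]
  have hthrough := subsets_sound (M := M) (by rw [Nat.shiftRight_zero]; omega)
    (fun b c hb hc hbc => near_sound hG hC hne hbc ((hM b).1 hb).1 ((hM c).1 hc).1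
      ((hM b).1 hb).2 ((hM c).1 hc).2) _ _ _ hblock (by simp)
    (fun i hi => Or.inr ((h16383 i).2 (bit_lt_of_lt hMlt hi)))
  have hC' := hC.addVertex (p := 14) (M := M) (by norm_num)
    (fun i hi e => hne i hi (hψx ▸ e.symm)) (by rw [hψx]; exact hM)
  refine hS (through_sound (E := ∅) hC' (Set.mem_insert _ _) ?_ (by simp) ?_ (by simp) (by simp)
    (by simp) hthrough)
  · exact fun X _ => ⟨∅, by simp, fun v hv => by simp at hv, by simp [bound]⟩
  · intro i hi
    rw [h16383] at hi
    exact ⟨Or.inr ⟨Nat.zero_le _, by omega⟩, by omega⟩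

/-- Two graphs with the same code, up to a permutation `σ` of the positions, are isomorphic. -/
theorem nonempty_iso_of_code {V : Type*} {G : SimpleGraph V} {φ : ℕ → V} {A : ℕ}
    (hA : IsCode G φ (Set.Icc 0 13) A) (hφ : ∀ v, ∃ i ∈ Set.Icc 0 13, φ i = v)
    {H : SimpleGraph (Fin 14)} (σ : Fin 14 → Fin 14) (hσ : Function.Injective σ)
    (h : ∀ i j : Fin 14, (row A i).testBit j = true ↔ H.Adj (σ i) (σ j)) : Nonempty (G ≃g H) := by
  have hmem : ∀ i : Fin 14, (i : ℕ) ∈ Set.Icc 0 13 := fun i => ⟨Nat.zero_le _, by omega⟩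
  have hbij : Function.Bijective fun i : Fin 14 => φ i := by
    constructor
    · intro i j e
      exact Fin.ext (hA.inj (hmem i) (hmem j) e)
    · intro v
      obtain ⟨i, hi, rfl⟩ := hφ v
      exact ⟨⟨i, by have := hi.2; omega⟩, rfl⟩
  let e := Equiv.ofBijective _ hbij
  let s := Equiv.ofBijective σ (Finite.injective_iff_bijective.1 hσ)
  refine ⟨SimpleGraph.Iso.symm ⟨s.symm.trans e, ?_⟩⟩
  intro a b
  obtain ⟨i, rfl⟩ := s.surjective a
  obtain ⟨j, rfl⟩ := s.surjective b
  rw [Equiv.trans_apply, Equiv.trans_apply, s.symm_apply_apply, s.symm_apply_apply]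
  change G.Adj (φ i) (φ j) ↔ H.Adj (σ i) (σ j)
  rw [← h i j, hA.row_iff]
  exact ⟨fun h => ⟨hmem i, hmem j, h⟩, fun h => h.2.2⟩

/-- A perfect graph has no induced cycle of odd length at least five. -/
theorem not_isPerfectGraph_of_odd_cycle {V : Type*} [Finite V] {G : SimpleGraph V} {n : ℕ}
    (hn : 2 ≤ n) (hodd : Odd n) (f : Fin n → V)
    (hf : ∀ i j, G.Adj (f i) (f j) ↔ (SimpleGraph.cycleGraph n).Adj i j)
    (hfree : ∀ i j k, (SimpleGraph.cycleGraph n).Adj i j → (SimpleGraph.cycleGraph n).Adj j k →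
      ¬ (SimpleGraph.cycleGraph n).Adj i k) : ¬ IsPerfectGraph G := by
  intro hG
  have h := hG (Set.range f)
  let g : SimpleGraph.cycleGraph n →g G.induce (Set.range f) :=
    ⟨fun i => ⟨f i, i, rfl⟩, fun {i j} e => (hf i j).2 e⟩
  have h3 := SimpleGraph.chromaticNumber_mono_of_hom g
  rw [SimpleGraph.chromaticNumber_cycleGraph_of_odd n hn hodd, h] at h3
  obtain ⟨t, ht, hc⟩ := (G.induce (Set.range f)).exists_isNClique_cliqueNum
  rw [← hc] at h3
  have h3 : 2 < t.card := by exact_mod_cast h3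
  obtain ⟨⟨_, i, rfl⟩, ha, ⟨_, j, rfl⟩, hb, ⟨_, k, rfl⟩, hc, hab, hac, hbc⟩ := two_lt_card.1 h3
  exact hfree i j k ((hf i j).1 (ht ha hb hab)) ((hf j k).1 (ht hb hc hbc))
    ((hf i k).1 (ht ha hc hac))

/-! ### Perfect graphs without dense sets -/

theorem isSparseSet_one_iff {V : Type*} {G : SimpleGraph V} {S : Finset V} :
    IsSparseSet G 1 S ↔ Sparse G S := by
  refine forall₂_congr fun v hv => ?_
  rw [Set.ncard_le_one (S.finite_toSet.subset fun w hw => hw.1)]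
  constructor
  · intro h u hu w hw e1 e2
    exact h u ⟨hu, e1⟩ w ⟨hw, e2⟩
  · rintro h u ⟨hu, e1⟩ w ⟨hw, e2⟩
    exact h u hu w hw e1 e2

theorem hasSparseSet_one_iff {V : Type*} {G : SimpleGraph V} {j : ℕ} :
    HasSparseSet G 1 j ↔ ∃ S, Sparse G S ∧ S.card = j := by
  unfold HasSparseSet
  simp only [isSparseSet_one_iff]
  exact exists_congr fun S => and_comm

theorem hasDenseSet_one_iff {V : Type*} {G : SimpleGraph V} {i : ℕ} :
    HasDenseSet G 1 i ↔ ∃ S, Sparse Gᶜ S ∧ S.card = i :=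
  hasSparseSet_one_iff

/-- A `1`-dense set of four vertices is the vertex set of a cycle of length four. -/
theorem hasDenseSet_four_iff {V : Type*} {G : SimpleGraph V} : HasDenseSet G 1 4 ↔
    ∃ a b c d, G.Adj a b ∧ G.Adj b c ∧ G.Adj c d ∧ G.Adj d a ∧ a ≠ c ∧ b ≠ d := by
  classical
  rw [hasDenseSet_one_iff]
  constructor
  · rintro ⟨S, hS, hc⟩
    -- `a` and `c` are non-adjacent if there are such vertices, and arbitrary otherwise
    obtain ⟨a, ha, c, hcS, hac, h⟩ : ∃ a ∈ S, ∃ c ∈ S, a ≠ c ∧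
        ((Gᶜ).Adj a c ∨ ∀ x ∈ S, ∀ y ∈ S, ¬ (Gᶜ).Adj x y) := by
      by_cases hex : ∃ x ∈ S, ∃ y ∈ S, (Gᶜ).Adj x y
      · obtain ⟨x, hx, y, hy, e⟩ := hex
        exact ⟨x, hx, y, hy, e.ne, Or.inl e⟩
      · push Not at hex
        obtain ⟨x, hx, y, hy, e⟩ := one_lt_card.1 (show 1 < S.card by omega)
        exact ⟨x, hx, y, hy, e, Or.inr hex⟩
    obtain ⟨b, d, hbd, he⟩ := card_eq_two.1 (show ((S.erase a).erase c).card = 2 by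
      rw [card_erase_of_mem (mem_erase.2 ⟨hac.symm, hcS⟩), card_erase_of_mem ha, hc])
    have hmem : ∀ x, (x = b ∨ x = d) → x ∈ S ∧ x ≠ a ∧ x ≠ c := by
      intro x hx
      have : x ∈ (S.erase a).erase c := by rw [he]; simpa using hx
      rw [mem_erase, mem_erase] at this
      exact ⟨this.2.2, this.2.1, this.1⟩
    have hadj : ∀ x, (x = b ∨ x = d) → G.Adj a x ∧ G.Adj c x := by
      intro x hx
      obtain ⟨h1, h2, h3⟩ := hmem x hx
      rcases h with h | h
      · constructor
        · by_contra hn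
          exact h3 (hS a ha x h1 c hcS ((G.compl_adj _ _).2 ⟨h2.symm, hn⟩) h)
        · by_contra hn
          exact h2 (hS c hcS x h1 a ha ((G.compl_adj _ _).2 ⟨h3.symm, hn⟩) h.symm)
      · constructor
        · by_contra hn
          exact h a ha x h1 ((G.compl_adj _ _).2 ⟨h2.symm, hn⟩)
        · by_contra hn
          exact h c hcS x h1 ((G.compl_adj _ _).2 ⟨h3.symm, hn⟩)
    exact ⟨a, b, c, d, (hadj b (Or.inl rfl)).1, (hadj b (Or.inl rfl)).2.symm,
      (hadj d (Or.inr rfl)).2, (hadj d (Or.inr rfl)).1.symm, hac, hbd⟩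
  · rintro ⟨a, b, c, d, hab, hbc, hcd, hda, hac, hbd⟩
    refine ⟨{a, b, c, d}, ?_, ?_⟩
    · intro v hv u hu w hw e1 e2
      rw [SimpleGraph.compl_adj] at e1 e2
      simp only [mem_insert, mem_singleton] at hv hu hw
      have hba := hab.symm
      have hcb := hbc.symm
      have hdc := hcd.symm
      have had := hda.symm
      rcases hv with rfl | rfl | rfl | rfl <;> rcases hu with rfl | rfl | rfl | rfl <;>
        rcases hw with rfl | rfl | rfl | rfl <;> simp_all
    · rw [card_insert_of_notMem, card_insert_of_notMem, card_insert_of_notMem, card_singleton]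
      · simpa using hcd.ne
      · simpa using ⟨hbc.ne, hbd⟩
      · simpa using ⟨hab.ne, hac, hda.ne'⟩

/-- In a graph without cycles of length four, a cycle of length five has no chords. -/
theorem noFourFiveCycle_of_isPerfectGraph {V : Type*} [Finite V] {G : SimpleGraph V}
    (hG : IsPerfectGraph G) (hd : ¬ HasDenseSet G 1 4) : NoFourFiveCycle G := by
  have h4 : ∀ a b c d, G.Adj a b → G.Adj b c → G.Adj c d → G.Adj d a → a = c ∨ b = d := by
    intro a b c d h1 h2 h3 h4
    by_contra h
    push Not at h
    exact hd (hasDenseSet_four_iff.2 ⟨a, b, c, d, h1, h2, h3, h4, h.1, h.2⟩)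
  refine ⟨h4, fun a b c d e hab hbc hcd hde hea nac nad nbd nbe nce => ?_⟩
  have mac : ¬ G.Adj a c := fun h => (h4 _ _ _ _ h hcd hde hea).elim nad nce
  have mbd : ¬ G.Adj b d := fun h => (h4 _ _ _ _ h hde hea hab).elim nbe nad.symm
  have mce : ¬ G.Adj c e := fun h => (h4 _ _ _ _ h hea hab hbc).elim nac.symm nbe.symm
  have mda : ¬ G.Adj d a := fun h => (h4 _ _ _ _ h hab hbc hcd).elim nbd.symm nac
  have meb : ¬ G.Adj e b := fun h => (h4 _ _ _ _ h hbc hcd hde).elim nce.symm nbd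
  refine not_isPerfectGraph_of_odd_cycle (n := 5) (by norm_num) (by decide) ![a, b, c, d, e] ?_
    (by decide) hG
  intro i j
  have hcyc : ∀ i j : Fin 5, (SimpleGraph.cycleGraph 5).Adj i j ↔ (i = j + 1 ∨ j = i + 1) := by
    decide
  rw [hcyc]
  fin_cases i <;> fin_cases j <;>
    simp [hab, hbc, hcd, hde, hea, mac, mbd, mce, mda, meb, G.adj_comm b a, G.adj_comm c b,
      G.adj_comm d c, G.adj_comm e d, G.adj_comm a e, G.adj_comm c a, G.adj_comm d b,
      G.adj_comm e c, G.adj_comm a d, G.adj_comm b e]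

/-- The chromatic number of an induced subgraph is at most three, and at most two unless the
subgraph contains a triangle; so it is the clique number if triangle-free sets of vertices are
two-colourable. -/
theorem isPerfectGraph_of_colorable {V : Type*} [Finite V] {G : SimpleGraph V} (h3 : G.Colorable 3)
    (h2 : ∀ s : Set V, (∀ a ∈ s, ∀ b ∈ s, ∀ c ∈ s, G.Adj a b → G.Adj b c → ¬ G.Adj a c) →
      (G.induce s).Colorable 2) : IsPerfectGraph G := by
  classical
  intro s
  refine le_antisymm ?_ (G.induce s).cliqueNum_le_chromaticNumber
  rw [SimpleGraph.chromaticNumber_le_iff_colorable]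
  by_cases hs : ∀ a ∈ s, ∀ b ∈ s, ∀ c ∈ s, G.Adj a b → G.Adj b c → ¬ G.Adj a c
  · by_cases he : ∃ a b : s, (G.induce s).Adj a b
    · obtain ⟨a, b, hab⟩ := he
      have hcl : (G.induce s).IsClique (({a, b} : Finset s) : Set s) := by
        rw [coe_pair, SimpleGraph.isClique_pair]
        exact fun _ => hab
      have := hcl.card_le_cliqueNum
      rw [card_pair hab.ne] at this
      exact (h2 s hs).mono this
    · push Not at he
      rcases isEmpty_or_nonempty s with hE | ⟨⟨a⟩⟩
      · exact SimpleGraph.Colorable.of_isEmpty _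
      · have hcl : (G.induce s).IsClique (({a} : Finset s) : Set s) := by
          rw [coe_singleton]
          exact SimpleGraph.isClique_singleton a
        have := hcl.card_le_cliqueNum
        rw [card_singleton] at this
        refine SimpleGraph.Colorable.mono this ?_
        rw [SimpleGraph.colorable_one_iff, SimpleGraph.eq_bot_iff_forall_not_adj]
        exact he
  · push Not at hs
    obtain ⟨a, ha, b, hb, c, hc, hab, hbc, hac⟩ := hs
    have hcl : (G.induce s).IsNClique 3 {⟨a, ha⟩, ⟨b, hb⟩, ⟨c, hc⟩} :=
      SimpleGraph.is3Clique_triple_iff.2 ⟨hab, hac, hbc⟩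
    have := hcl.isClique.card_le_cliqueNum
    rw [hcl.card_eq] at this
    exact (h3.of_hom (SimpleGraph.Embedding.induce s).toHom).mono this

theorem isPerfectGraph_of_colorable_two {V : Type*} [Finite V] {G : SimpleGraph V}
    (h : G.Colorable 2) : IsPerfectGraph G :=
  isPerfectGraph_of_colorable (h.mono (by norm_num)) fun s _ =>
    h.of_hom (SimpleGraph.Embedding.induce s).toHom

/-! ### The extremal graphs -/

/-- The adjacency matrix of `heawoodGraph`, one row in every sixteen binary digits. -/
def heawoodCode : ℕ := 1790784662739919017716260605122269406288121765552242454293515673634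

/-- The adjacency matrix of `extremalGraph₂`, one row in every sixteen binary digits. -/
def extremalCode₂ : ℕ := 2527970855897808574766781761184712082704818768185582086988597895174

/-- The adjacency matrix of `extremalGraph₃`, one row in every sixteen binary digits. -/
def extremalCode₃ : ℕ := 2527970855897808563074768662537488737075340106455029699364985839622

theorem heawoodGraph_adj : ∀ i j : Fin 14,
    (row (heawoodCode <<< 32) i).testBit j = true ↔ heawoodGraph.Adj i j := by
  simp only [heawoodGraph, SimpleGraph.fromRel_adj]
  decide +kernel

theorem extremalGraph₂_adj : ∀ i j : Fin 14,
    (row (extremalCode₂ <<< 32) i).testBit j = true ↔ extremalGraph₂.Adj i j := by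
  simp only [extremalGraph₂, SimpleGraph.fromRel_adj]
  decide +kernel

theorem extremalGraph₃_adj : ∀ i j : Fin 14,
    (row (extremalCode₃ <<< 32) i).testBit j = true ↔ extremalGraph₃.Adj i j := by
  simp only [extremalGraph₃, SimpleGraph.deleteEdges_adj, ← extremalGraph₂_adj,
    Set.mem_singleton_iff, Sym2.eq_iff]
  decide +kernel

theorem extremalGraph₃_le : extremalGraph₃ ≤ extremalGraph₂ := SimpleGraph.deleteEdges_le _

theorem isCode_of_adj {H : SimpleGraph (Fin 14)} {C : ℕ} (hC : C < 2 ^ 224)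
    (hA : ∀ i < 14, row (C <<< 32) i < 2 ^ 14)
    (h : ∀ i j : Fin 14, (row (C <<< 32) i).testBit j = true ↔ H.Adj i j) :
    IsCode H (fun i => Fin.ofNat 14 i) (Set.Icc 0 13) (C <<< 32) := by
  have hA' : ∀ i, 14 ≤ i → row (C <<< 32) i = 0 := by
    intro i hi
    apply Nat.eq_of_testBit_eq
    intro j
    rw [testBit_row, Nat.testBit_shiftLeft, Nat.zero_testBit, Nat.testBit_lt_two_pow (x := C)
      (hC.trans_le (Nat.pow_le_pow_right (by norm_num) (by omega)))]
    simp
  have hval : ∀ i, i ≤ 13 → (Fin.ofNat 14 i : Fin 14).val = i := fun i hi =>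
    Nat.mod_eq_of_lt (by omega)
  refine ⟨?_, ?_, ?_⟩
  · rintro i ⟨-, hi⟩ j ⟨-, hj⟩ e
    have := congrArg Fin.val e
    rwa [hval i hi, hval j hj] at this
  · rintro i ⟨-, hi⟩
    omega
  · intro i j
    by_cases hi : i ≤ 13
    · by_cases hj : j ≤ 13
      · rw [← h, hval i hi, hval j hj]
        simp [hi, hj]
      · constructor
        · intro hb
          have := bit_lt_of_lt (hA i (by omega)) hb
          omega
        · rintro ⟨-, ⟨-, hj'⟩, -⟩
          exact (hj hj').elim
    · rw [hA' i (by omega)]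
      simp [hi]

/-- Every set of `j` positions contains one with two neighbours in the set. -/
noncomputable def noSparse (A j : ℕ) : Bool :=
  Nat.rec true (fun x ih => sel (sel (Nat.beq (popCount x) j)
    (anyBits (fun i => Nat.blt 1 (popCount (Nat.land (row A i) x))) x) true) ih false) 16384

theorem not_hasSparseSet_of_noSparse {V : Type*} {G : SimpleGraph V} {φ : ℕ → V} {A j : ℕ}
    (hA : IsCode G φ (Set.Icc 0 13) A) (hφ : ∀ v, ∃ i ∈ Set.Icc 0 13, φ i = v)
    (h : noSparse A j = true) : ¬ HasSparseSet G 1 j := by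
  classical
  rw [hasSparseSet_one_iff]
  rintro ⟨S, hS, hc⟩
  obtain ⟨x, hx⟩ : ∃ x : ℕ, ∀ i, x.testBit i = true ↔ i ∈ Set.Icc 0 13 ∧ φ i ∈ S := by
    refine ⟨Nat.ofBits fun j : Fin 14 => decide (φ j ∈ S), fun i => ?_⟩
    by_cases hi : i < 14
    · rw [Nat.testBit_ofBits_lt _ _ hi, decide_eq_true_iff]
      exact ⟨fun h => ⟨⟨Nat.zero_le _, by omega⟩, h⟩, fun h => h.2⟩
    · rw [Nat.testBit_ofBits_ge _ _ (by omega)]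
      simp
      omega
  have hx14 : x < 2 ^ 14 := lt_two_pow_of_bits fun i hi => by
    have := ((hx i).1 hi).1.2
    omega
  have himage : (ones x).image φ = S := by
    ext v
    rw [mem_image]
    constructor
    · rintro ⟨i, hi, rfl⟩
      exact ((hx i).1 (mem_ones.1 hi).2).2
    · intro hv
      obtain ⟨i, hi, rfl⟩ := hφ v
      exact ⟨i, (mem_ones_of_lt hx14 (by norm_num)).2 ((hx i).2 ⟨hi, hv⟩), rfl⟩
  have hpop : popCount x = j := by
    rw [popCount_eq hx14, ← card_image_ones hA.inj fun i hi => ((hx i).1 hi).1, himage, hc]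
  have hall : ∀ n : ℕ, (Nat.rec true (fun x ih => sel (sel (Nat.beq (popCount x) j)
      (anyBits (fun i => Nat.blt 1 (popCount (Nat.land (row A i) x))) x) true) ih false) n : Bool)
      = true → ∀ x < n, popCount x = j →
      anyBits (fun i => Nat.blt 1 (popCount (Nat.land (row A i) x))) x = true := by
    intro n
    induction n with
    | zero => intro _ x hx; omega
    | succ n ih =>
      intro hn x hx hp
      obtain ⟨h1, h2⟩ := sel_false_right.1 hn
      rcases Nat.lt_succ_iff_lt_or_eq.1 hx with h3 | rfl
      · exact ih h2 x h3 hp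
      · exact sel_true_right.1 h1 (by rw [hp]; exact Nat.beq_refl _)
  obtain ⟨i, hi, h2⟩ := (anyBits_iff _ (hx14.trans (by norm_num))).1 (hall _ h x hx14 hpop)
  have hb : ∀ k, (Nat.land (row A i) x).testBit k = true ↔
      (row A i).testBit k = true ∧ x.testBit k = true := by
    intro k
    change (row A i &&& x).testBit k = true ↔ _
    rw [Nat.testBit_and, Bool.and_eq_true]
  have hlt : Nat.land (row A i) x < 2 ^ 14 :=
    lt_two_pow_of_bits fun k hk => bit_lt_of_lt hx14 ((hb k).1 hk).2
  rw [popCount_eq hlt] at h2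
  obtain ⟨k, hk, l, hl, hkl⟩ := one_lt_card.1
    (show 1 < (ones (Nat.land (row A i) x)).card from Nat.le_of_ble_eq_true h2)
  obtain ⟨hk1, hk2⟩ := (hb k).1 (mem_ones.1 hk).2
  obtain ⟨hl1, hl2⟩ := (hb l).1 (mem_ones.1 hl).2
  exact hkl (hA.inj ((hx k).1 hk2).1 ((hx l).1 hl2).1
    (hS _ ((hx i).1 (mem_ones.1 hi).2).2 _ ((hx k).1 hk2).2 _ ((hx l).1 hl2).2
      ((hA.row_iff i k).1 hk1).2.2 ((hA.row_iff i l).1 hl1).2.2))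

theorem not_hasDenseSet_of_code {V : Type*} {G : SimpleGraph V} {φ : ℕ → V} {A : ℕ}
    (hA : IsCode G φ (Set.Icc 0 13) A) (hφ : ∀ v, ∃ i ∈ Set.Icc 0 13, φ i = v)
    (h : ∀ i < 14, ∀ j < i, popCount (Nat.land (row A i) (row A j)) ≤ 1) :
    ¬ HasDenseSet G 1 4 := by
  rw [hasDenseSet_four_iff]
  rintro ⟨a, b, c, d, hab, hbc, hcd, hda, hac, hbd⟩
  obtain ⟨i, hi, rfl⟩ := hφ a
  obtain ⟨k, hk, rfl⟩ := hφ b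
  obtain ⟨j, hj, rfl⟩ := hφ c
  obtain ⟨l, hl, rfl⟩ := hφ d
  have key : ∀ i ∈ Set.Icc 0 13, ∀ j ∈ Set.Icc 0 13, j < i → G.Adj (φ i) (φ k) →
      G.Adj (φ k) (φ j) → G.Adj (φ j) (φ l) → G.Adj (φ l) (φ i) → False := by
    intro i hi j hj hij hik hkj hjl hli
    have hb : ∀ k, (Nat.land (row A i) (row A j)).testBit k = true ↔
        (row A i).testBit k = true ∧ (row A j).testBit k = true := by
      intro k
      change (row A i &&& row A j).testBit k = true ↔ _
      rw [Nat.testBit_and, Bool.and_eq_true]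
    have hlt : Nat.land (row A i) (row A j) < 2 ^ 14 := lt_two_pow_of_bits fun k hk => by
      have := ((hA.row_iff i k).1 ((hb k).1 hk).1).2.1.2
      omega
    have h1 := h i (by have := hi.2; omega) j hij
    rw [popCount_eq hlt] at h1
    have hmem : ∀ m ∈ Set.Icc 0 13, G.Adj (φ i) (φ m) → G.Adj (φ j) (φ m) →
        m ∈ ones (Nat.land (row A i) (row A j)) := fun m hm e1 e2 =>
      (mem_ones_of_lt hlt (by norm_num)).2
        ((hb m).2 ⟨(hA.row_iff i m).2 ⟨hi, hm, e1⟩, (hA.row_iff j m).2 ⟨hj, hm, e2⟩⟩)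
    exact hbd (congrArg φ (card_le_one.1 h1 k (hmem k hk hik hkj.symm) l (hmem l hl hli.symm hjl)))
  rcases lt_trichotomy i j with hlt | rfl | hlt
  · exact key j hj i hi hlt hbc.symm hab.symm hda.symm hcd.symm
  · exact hac rfl
  · exact key i hi j hj hlt hab hbc hcd hda

theorem surj_ofNat (v : Fin 14) : ∃ i ∈ Set.Icc 0 13, (fun i => Fin.ofNat 14 i) i = v :=
  ⟨v, ⟨Nat.zero_le _, by omega⟩, by ext; exact Nat.mod_eq_of_lt v.2⟩

theorem isCode_heawood :
    IsCode heawoodGraph (fun i => Fin.ofNat 14 i) (Set.Icc 0 13) (heawoodCode <<< 32) :=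
  isCode_of_adj (by decide +kernel) (by decide +kernel) heawoodGraph_adj

theorem isCode_extremal₂ :
    IsCode extremalGraph₂ (fun i => Fin.ofNat 14 i) (Set.Icc 0 13) (extremalCode₂ <<< 32) :=
  isCode_of_adj (by decide +kernel) (by decide +kernel) extremalGraph₂_adj

theorem isCode_extremal₃ :
    IsCode extremalGraph₃ (fun i => Fin.ofNat 14 i) (Set.Icc 0 13) (extremalCode₃ <<< 32) :=
  isCode_of_adj (by decide +kernel) (by decide +kernel) extremalGraph₃_adj

theorem heawoodGraph_not_hasSparseSet : ¬ HasSparseSet heawoodGraph 1 8 :=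
  not_hasSparseSet_of_noSparse isCode_heawood surj_ofNat (by decide +kernel)

theorem extremalGraph₂_not_hasSparseSet : ¬ HasSparseSet extremalGraph₂ 1 8 :=
  not_hasSparseSet_of_noSparse isCode_extremal₂ surj_ofNat (by decide +kernel)

theorem extremalGraph₃_not_hasSparseSet : ¬ HasSparseSet extremalGraph₃ 1 8 :=
  not_hasSparseSet_of_noSparse isCode_extremal₃ surj_ofNat (by decide +kernel)

theorem heawoodGraph_not_hasDenseSet : ¬ HasDenseSet heawoodGraph 1 4 :=
  not_hasDenseSet_of_code isCode_heawood surj_ofNat (by decide +kernel)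

theorem extremalGraph₂_not_hasDenseSet : ¬ HasDenseSet extremalGraph₂ 1 4 :=
  not_hasDenseSet_of_code isCode_extremal₂ surj_ofNat (by decide +kernel)

theorem extremalGraph₃_not_hasDenseSet : ¬ HasDenseSet extremalGraph₃ 1 4 :=
  not_hasDenseSet_of_code isCode_extremal₃ surj_ofNat (by decide +kernel)

/-! ### Perfectness and the classification -/

/-- No two elements of `a` are adjacent. -/
noncomputable def independent (A a : ℕ) : Bool :=
  anyBits (fun i => Nat.blt 0 (Nat.land (row A i) a)) a |>.not

/-- Breadth-first two-colouring: `rem` consists of the uncoloured vertices, `a` and `b` of those of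
the two colours, and `f` is the last layer, which has colour `a`. When a component is exhausted, a
new one is started. The colouring is only checked at the end. -/
noncomputable def twoColour (A fuel : ℕ) : ℕ → ℕ → ℕ → ℕ → Bool :=
  Nat.rec (fun _ _ _ _ => false) (fun _ ih rem f a b =>
    force rem fun rem => force (Nat.land (orBits (row A) f) rem) fun n =>
    sel (Nat.beq n 0)
      (sel (Nat.beq rem 0) (sel (independent A a) (independent A b) false)
        (force (bit (lowIdx rem)) fun s => ih (Nat.xor rem s) s (Nat.lor a s) b))
      (ih (Nat.xor rem n) n (Nat.lor b n) a)) fuel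

/-- The set `x` becomes two-colourable whenever one vertex of each of the triangles `ts` is
removed. -/
noncomputable def hittingTwoColour (A : ℕ) (ts : List (ℕ × ℕ × ℕ)) : ℕ → Bool :=
  List.rec (fun x => force x fun x => twoColour A 32 x 0 0 0) (fun t _ ih x => force x fun x =>
    sel (ih (diff x (bit t.1))) (sel (ih (diff x (bit t.2.1))) (ih (diff x (bit t.2.2))) false)
      false) ts

theorem independent_iff {A a : ℕ} (ha : a < 2 ^ 16) : independent A a = true ↔
    ∀ i j, a.testBit i = true → a.testBit j = true → ¬ (row A i).testBit j = true := by
  unfold independent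
  rw [Bool.not_eq_true', ← Bool.not_eq_true, anyBits_iff _ ha]
  constructor
  · intro h i j hi hj hij
    refine h ⟨i, (mem_ones_of_lt ha le_rfl).2 hi, Nat.ble_eq_true_of_le (Nat.pos_of_ne_zero ?_)⟩
    intro h0
    have : (row A i &&& a).testBit j = true := by rw [Nat.testBit_and, hij, hj]; rfl
    rw [show row A i &&& a = 0 from h0] at this
    simp at this
  · rintro h ⟨i, hi, h0⟩
    have h0 : Nat.land (row A i) a ≠ 0 := Nat.ne_of_gt (Nat.le_of_ble_eq_true h0)
    have h1 : (row A i &&& a).testBit _ = true := Nat.testBit_log2 h0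
    rw [Nat.testBit_and, Bool.and_eq_true] at h1
    exact h i _ (mem_ones.1 hi).2 h1.2 h1.1

theorem testBit_xor_of_subset {x y : ℕ} {i : ℕ} (h : x.testBit i = true) :
    (Nat.xor x y).testBit i = true ∨ y.testBit i = true := by
  change (x ^^^ y).testBit i = true ∨ _
  rw [Nat.testBit_xor, h]
  cases y.testBit i <;> simp

theorem twoColour_sound {A x : ℕ} : ∀ fuel rem f a b, twoColour A fuel rem f a b = true →
    rem < 2 ^ 16 → a < 2 ^ 16 → b < 2 ^ 16 →
    (∀ i, x.testBit i = true → rem.testBit i = true ∨ a.testBit i = true ∨ b.testBit i = true) →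
    ∃ a b : ℕ, (∀ i, x.testBit i = true → a.testBit i = true ∨ b.testBit i = true) ∧
      (∀ i j, a.testBit i = true → a.testBit j = true → ¬ (row A i).testBit j = true) ∧
      ∀ i j, b.testBit i = true → b.testBit j = true → ¬ (row A i).testBit j = true := by
  intro fuel
  induction fuel with
  | zero => intro rem f a b h; cases h
  | succ fuel ih =>
    intro rem f a b h hrem ha hb hx
    change force rem (fun rem => force (Nat.land (orBits (row A) f) rem) fun n =>
      sel (Nat.beq n 0)
        (sel (Nat.beq rem 0) (sel (independent A a) (independent A b) false)
          (force (bit (lowIdx rem)) fun s => twoColour A fuel (Nat.xor rem s) s (Nat.lor a s) b))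
        (twoColour A fuel (Nat.xor rem n) n (Nat.lor b n) a)) = true at h
    simp only [force_eq] at h
    have hlor : ∀ c s i : ℕ, (Nat.lor c s).testBit i = true ↔
        c.testBit i = true ∨ s.testBit i = true := by
      intro c s i
      change (c ||| s).testBit i = true ↔ _
      rw [Nat.testBit_or, Bool.or_eq_true]
    rw [sel_eq] at h
    split_ifs at h with hn
    · rw [sel_eq] at h
      split_ifs at h with h0
      · obtain ⟨h1, h2⟩ := sel_false_right.1 h
        refine ⟨a, b, fun i hi => (hx i hi).resolve_left ?_, (independent_iff ha).1 h1,
          (independent_iff hb).1 h2⟩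
        rw [Nat.eq_of_beq_eq_true h0]
        simp
      · have hlow := lowIdx_spec (x := rem) (by rintro rfl; exact h0 rfl)
        have hs : bit (lowIdx rem) < 2 ^ 16 := lt_two_pow_of_bits fun i hi => by
          rw [testBit_bit, decide_eq_true_iff] at hi
          exact hi ▸ bit_lt_of_lt hrem hlow.1
        refine ih _ _ _ _ h (Nat.xor_lt_two_pow hrem hs) (Nat.or_lt_two_pow ha hs) hb ?_
        intro i hi
        rw [hlor]
        rcases hx i hi with h1 | h1 | h1
        · rcases testBit_xor_of_subset h1 with h2 | h2
          · exact Or.inl h2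
          · exact Or.inr (Or.inl (Or.inr h2))
        · exact Or.inr (Or.inl (Or.inl h1))
        · exact Or.inr (Or.inr h1)
    · have hn : Nat.land (orBits (row A) f) rem < 2 ^ 16 :=
        (Nat.and_le_right (n := orBits (row A) f) (m := rem)).trans_lt hrem
      refine ih _ _ _ _ h (Nat.xor_lt_two_pow hrem hn) (Nat.or_lt_two_pow hb hn) ha ?_
      intro i hi
      rw [hlor]
      rcases hx i hi with h1 | h1 | h1
      · rcases testBit_xor_of_subset (y := Nat.land (orBits (row A) f) rem) h1 with h2 | h2
        · exact Or.inl h2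
        · exact Or.inr (Or.inl (Or.inr h2))
      · exact Or.inr (Or.inr h1)
      · exact Or.inr (Or.inl (Or.inl h1))

theorem hittingTwoColour_sound {A x : ℕ} {ts : List (ℕ × ℕ × ℕ)}
    (hx : ∀ t ∈ ts, ¬ (x.testBit t.1 = true ∧ x.testBit t.2.1 = true ∧ x.testBit t.2.2 = true)) :
    ∀ y, y < 2 ^ 16 → (∀ i, x.testBit i = true → y.testBit i = true) →
    hittingTwoColour A ts y = true →
    ∃ a b : ℕ, (∀ i, x.testBit i = true → a.testBit i = true ∨ b.testBit i = true) ∧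
      (∀ i j, a.testBit i = true → a.testBit j = true → ¬ (row A i).testBit j = true) ∧
      ∀ i j, b.testBit i = true → b.testBit j = true → ¬ (row A i).testBit j = true := by
  induction ts with
  | nil =>
    intro y hy hxy h
    change force y (fun x => twoColour A 32 x 0 0 0) = true at h
    rw [force_eq] at h
    exact twoColour_sound _ _ _ _ _ h hy (by norm_num) (by norm_num) fun i hi => Or.inl (hxy i hi)
  | cons t ts ih =>
    intro y hy hxy h
    change force y (fun x => sel (hittingTwoColour A ts (diff x (bit t.1)))
      (sel (hittingTwoColour A ts (diff x (bit t.2.1))) (hittingTwoColour A ts (diff x (bit t.2.2)))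
        false) false) = true at h
    rw [force_eq, sel_false_right, sel_false_right] at h
    have key : ∀ k, ¬ x.testBit k = true → hittingTwoColour A ts (diff y (bit k)) = true → _ :=
      fun k hk hh => ih (fun t ht => hx t (List.mem_cons_of_mem _ ht)) (diff y (bit k))
        (lt_two_pow_of_bits fun i hi => by
          rw [testBit_diff, Bool.and_eq_true] at hi
          exact bit_lt_of_lt hy hi.1)
        (fun i hi => by
          rw [testBit_diff, testBit_bit, Bool.and_eq_true, Bool.not_eq_true',
            decide_eq_false_iff_not]
          exact ⟨hxy i hi, fun e => hk (e ▸ hi)⟩) hh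
    by_cases h1 : x.testBit t.1 = true
    · by_cases h2 : x.testBit t.2.1 = true
      · exact key _ (fun h3 => hx t List.mem_cons_self ⟨h1, h2, h3⟩) h.2.2
      · exact key _ h2 h.2.1
    · exact key _ h1 h.1

/-- The six triangles of `extremalGraph₂`. -/
def chainTriangles : List (ℕ × ℕ × ℕ) :=
  [(0, 1, 2), (2, 3, 4), (4, 5, 6), (7, 8, 9), (9, 10, 11), (11, 12, 13)]

theorem hittingTwoColour_extremal :
    hittingTwoColour (extremalCode₂ <<< 32) chainTriangles 16383 = true := by
  decide +kernel

theorem chainTriangles_adj : ∀ t ∈ chainTriangles, ∀ i j k : Fin 14,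
    (i, j, k) = (Fin.ofNat 14 t.1, Fin.ofNat 14 t.2.1, Fin.ofNat 14 t.2.2) →
    (row (extremalCode₃ <<< 32) i).testBit j = true ∧
      (row (extremalCode₃ <<< 32) j).testBit k = true ∧
      (row (extremalCode₃ <<< 32) i).testBit k = true := by
  decide +kernel

/-- The triangles of `extremalGraph₂` all lie in `extremalGraph₃`, and a set of vertices containing
none of them is two-colourable. -/
theorem induce_colorable_two (s : Set (Fin 14))
    (hs : ∀ a ∈ s, ∀ b ∈ s, ∀ c ∈ s, extremalGraph₃.Adj a b → extremalGraph₃.Adj b c →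
      ¬ extremalGraph₃.Adj a c) : (extremalGraph₂.induce s).Colorable 2 := by
  classical
  obtain ⟨x, hx⟩ : ∃ x : ℕ, ∀ i, x.testBit i = true ↔ i < 14 ∧ Fin.ofNat 14 i ∈ s := by
    refine ⟨Nat.ofBits fun j : Fin 14 => decide (j ∈ s), fun i => ?_⟩
    by_cases hi : i < 14
    · rw [Nat.testBit_ofBits_lt _ _ hi, decide_eq_true_iff]
      have : (⟨i, hi⟩ : Fin 14) = Fin.ofNat 14 i := Fin.ext (Nat.mod_eq_of_lt hi).symm
      rw [this]
      exact ⟨fun h => ⟨hi, h⟩, fun h => h.2⟩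
    · rw [Nat.testBit_ofBits_ge _ _ (by omega)]
      simp
      omega
  have hxs : ∀ i : Fin 14, i ∈ s → x.testBit i = true := fun i hi => by
    have : (Fin.ofNat 14 (i : ℕ) : Fin 14) = i := Fin.ext (Nat.mod_eq_of_lt i.2)
    exact (hx i).2 ⟨i.2, by rwa [this]⟩
  obtain ⟨a, b, hab, ha, hb⟩ := hittingTwoColour_sound (x := x) (by
    rintro t ht ⟨h1, h2, h3⟩
    obtain ⟨e1, e2, e3⟩ := chainTriangles_adj t ht _ _ _ rfl
    rw [extremalGraph₃_adj] at e1 e2 e3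
    exact hs _ ((hx _).1 h1).2 _ ((hx _).1 h2).2 _ ((hx _).1 h3).2 e1 e2 e3) 16383 (by norm_num)
    (fun i hi => by
      rw [show 16383 = 2 ^ 14 - 1 by norm_num, Nat.testBit_two_pow_sub_one, decide_eq_true_iff]
      exact ((hx i).1 hi).1) hittingTwoColour_extremal
  refine ⟨SimpleGraph.Coloring.mk (fun v => if a.testBit (v : Fin 14) = true then 0 else 1) ?_⟩
  intro v w hvw
  have hvw : extremalGraph₂.Adj v w := hvw
  rw [← extremalGraph₂_adj] at hvw
  have hv := hab _ (hxs _ v.2)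
  have hw := hab _ (hxs _ w.2)
  by_cases h1 : a.testBit (v : Fin 14) = true <;> by_cases h2 : a.testBit (w : Fin 14) = true
  · exact (ha _ _ h1 h2 hvw).elim
  · simp [h1, h2]
  · simp [h1, h2]
  · exact (hb _ _ (hv.resolve_left h1) (hw.resolve_left h2) hvw).elim

theorem extremalGraph₂_colorable : extremalGraph₂.Colorable 3 := by
  refine ⟨SimpleGraph.Coloring.mk ![0, 1, 2, 0, 1, 0, 2, 0, 2, 1, 2, 0, 1, 2] ?_⟩
  intro v w
  rw [← extremalGraph₂_adj]
  revert v w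
  decide +kernel

theorem extremalGraph₂_isPerfectGraph : IsPerfectGraph extremalGraph₂ :=
  isPerfectGraph_of_colorable extremalGraph₂_colorable fun s hs => induce_colorable_two s
    fun a ha b hb c hc e1 e2 e3 => hs a ha b hb c hc (extremalGraph₃_le e1) (extremalGraph₃_le e2)
      (extremalGraph₃_le e3)

theorem extremalGraph₃_isPerfectGraph : IsPerfectGraph extremalGraph₃ :=
  isPerfectGraph_of_colorable (extremalGraph₂_colorable.mono_left extremalGraph₃_le) fun s hs =>
    (induce_colorable_two s hs).mono_left (SimpleGraph.comap_monotone _ extremalGraph₃_le)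

theorem heawoodGraph_colorable : heawoodGraph.Colorable 2 := by
  refine ⟨SimpleGraph.Coloring.mk ![0, 1, 0, 1, 0, 1, 0, 1, 0, 1, 0, 1, 0, 1] ?_⟩
  intro v w
  rw [← heawoodGraph_adj]
  revert v w
  decide +kernel

/-- Isomorphic graphs have equally many ordered pairs of adjacent vertices. -/
theorem card_adj_eq {G H : SimpleGraph (Fin 14)} {A B : ℕ}
    (hG : ∀ i j : Fin 14, (row A i).testBit j = true ↔ G.Adj i j)
    (hH : ∀ i j : Fin 14, (row B i).testBit j = true ↔ H.Adj i j) (f : G ≃g H) :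
    (univ.filter fun p : Fin 14 × Fin 14 => (row A p.1).testBit p.2 = true).card =
      (univ.filter fun p : Fin 14 × Fin 14 => (row B p.1).testBit p.2 = true).card := by
  refine card_equiv (f.toEquiv.prodCongr f.toEquiv) fun p => ?_
  simp only [mem_filter, mem_univ, true_and, hG]
  rw [hH]
  exact (f.map_adj_iff).symm

theorem card_adj_heawood : (univ.filter fun p : Fin 14 × Fin 14 =>
    (row (heawoodCode <<< 32) p.1).testBit p.2 = true).card = 42 := by
  decide +kernel

theorem card_adj_extremal₂ : (univ.filter fun p : Fin 14 × Fin 14 =>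
    (row (extremalCode₂ <<< 32) p.1).testBit p.2 = true).card = 46 := by
  decide +kernel

theorem card_adj_extremal₃ : (univ.filter fun p : Fin 14 × Fin 14 =>
    (row (extremalCode₃ <<< 32) p.1).testBit p.2 = true).card = 44 := by
  decide +kernel

theorem isPerfectExtremal_of_fin {G : SimpleGraph (Fin 14)} (hG : IsPerfectGraph G)
    (hd : ¬ HasDenseSet G 1 4) (hs : ¬ HasSparseSet G 1 8) : IsPerfectExtremal 1 4 8 15 G :=
  ⟨by simp, hG, hd, hs⟩

/-- Six of the seven codes belong to the three extremal graphs, each of which occurs twice. -/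
theorem nonempty_iso_of_mem_leafCodes {V : Type*} [Finite V] {G : SimpleGraph V}
    (hG : IsPerfectGraph G) {φ : ℕ → V} {C : ℕ} (hA : IsCode G φ (Set.Icc 0 13) (C <<< 32))
    (hφ : ∀ v, ∃ i ∈ Set.Icc 0 13, φ i = v) (hC : C ∈ leafCodes) :
    Nonempty (G ≃g heawoodGraph) ∨ Nonempty (G ≃g extremalGraph₂) ∨
      Nonempty (G ≃g extremalGraph₃) := by
  simp only [leafCodes, List.mem_cons, List.not_mem_nil, or_false] at hC
  rcases hC with rfl | rfl | rfl | rfl | rfl | rfl | rfl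
  · refine Or.inr (Or.inl (nonempty_iso_of_code hA hφ
      ![9, 11, 7, 12, 8, 13, 10, 6, 5, 1, 0, 3, 4, 2] (by decide +kernel) ?_))
    simp only [← extremalGraph₂_adj]
    decide +kernel
  · refine Or.inr (Or.inl (nonempty_iso_of_code hA hφ
      ![9, 11, 12, 7, 8, 13, 10, 5, 6, 1, 0, 3, 4, 2] (by decide +kernel) ?_))
    simp only [← extremalGraph₂_adj]
    decide +kernel
  · -- a ring of seven triangles, whose seven vertices of degree four form an induced cycle
    refine (not_isPerfectGraph_of_odd_cycle (n := 7) (by norm_num) (by decide)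
      (fun i => φ ((![2, 4, 8, 12, 13, 10, 6] : Fin 7 → Fin 14) i)) ?_ (by decide +kernel) hG).elim
    intro i j
    have h : ∀ i j : Fin 7, (row
        (3159435439162521785838912090393585700181776338008622289654399631380 <<< 32)
        ((![2, 4, 8, 12, 13, 10, 6] : Fin 7 → Fin 14) i)).testBit
        ((![2, 4, 8, 12, 13, 10, 6] : Fin 7 → Fin 14) j) = true ↔
        (SimpleGraph.cycleGraph 7).Adj i j := by
      decide +kernel
    rw [← h, hA.row_iff]
    exact ⟨fun e => ⟨⟨Nat.zero_le _, by omega⟩, ⟨Nat.zero_le _, by omega⟩, e⟩, fun e => e.2.2⟩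
  · refine Or.inr (Or.inr (nonempty_iso_of_code hA hφ
      ![10, 9, 11, 7, 12, 8, 13, 6, 5, 1, 0, 3, 4, 2] (by decide +kernel) ?_))
    simp only [← extremalGraph₃_adj]
    decide +kernel
  · refine Or.inr (Or.inr (nonempty_iso_of_code hA hφ
      ![10, 9, 11, 12, 7, 8, 13, 5, 6, 1, 0, 3, 4, 2] (by decide +kernel) ?_))
    simp only [← extremalGraph₃_adj]
    decide +kernel
  · refine Or.inl (nonempty_iso_of_code hA hφ
      ![11, 9, 7, 3, 8, 12, 6, 4, 10, 2, 13, 5, 1, 0] (by decide +kernel) ?_)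
    simp only [← heawoodGraph_adj]
    decide +kernel
  · refine Or.inl (nonempty_iso_of_code hA hφ
      ![11, 9, 7, 3, 12, 8, 6, 4, 10, 2, 13, 5, 1, 0] (by decide +kernel) ?_)
    simp only [← heawoodGraph_adj]
    decide +kernel

theorem nonempty_iso_of_isPerfectExtremal {V : Type*} [Finite V] {G : SimpleGraph V}
    (h : IsPerfectExtremal 1 4 8 15 G) : Nonempty (G ≃g heawoodGraph) ∨
      Nonempty (G ≃g extremalGraph₂) ∨ Nonempty (G ≃g extremalGraph₃) := by
  have := Fintype.ofFinite V
  have hV : Fintype.card V = 14 := by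
    have := h.order
    rw [Nat.card_eq_fintype_card] at this
    omega
  obtain ⟨φ, A, hA, hφ, hC⟩ := exists_code (noFourFiveCycle_of_isPerfectGraph h.perfect h.noDense)
    hV (fun hS => h.noSparse (hasSparseSet_one_iff.2 hS))
  exact nonempty_iso_of_mem_leafCodes h.perfect hA.shift hφ hC

/-- Induced subgraphs of the Heawood graph show that no smaller number of vertices suffices. -/
theorem isPerfectDefectiveRamsey : IsPerfectDefectiveRamsey 1 4 8 15 := by
  constructor
  · intro G hG
    by_contra h
    push Not at h
    exact h.2 (hasSparseSet_one_iff.2 (forcesSparse_fifteen (Fin 15) G (Fintype.card_fin 15)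
      (noFourFiveCycle_of_isPerfectGraph hG h.1)))
  · intro n hn
    by_contra hlt
    let f : Fin n ↪ Fin 14 := Fin.castLEEmb (show n ≤ 14 by omega)
    have hperf : IsPerfectGraph (heawoodGraph.comap f) :=
      isPerfectGraph_of_colorable_two (heawoodGraph_colorable.of_hom
        (SimpleGraph.Embedding.comap f heawoodGraph).toHom)
    rcases hn _ hperf with h | h
    · obtain ⟨a, b, c, d, h1, h2, h3, h4, h5, h6⟩ := hasDenseSet_four_iff.1 h
      exact heawoodGraph_not_hasDenseSet (hasDenseSet_four_iff.2 ⟨f a, f b, f c, f d, h1, h2, h3,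
        h4, f.injective.ne h5, f.injective.ne h6⟩)
    · obtain ⟨S, hS, hc⟩ := hasSparseSet_one_iff.1 h
      exact heawoodGraph_not_hasSparseSet (hasSparseSet_one_iff.2
        ⟨S.map f, hS.map, by rw [card_map, hc]⟩)

end SparseSearch

open SparseSearch in
theorem theorem3p1 :
    IsPerfectDefectiveRamsey 1 4 8 15 ∧
    IsPerfectExtremal 1 4 8 15 heawoodGraph ∧
    IsPerfectExtremal 1 4 8 15 extremalGraph₂ ∧
    IsPerfectExtremal 1 4 8 15 extremalGraph₃ ∧
    IsEmpty (heawoodGraph ≃g extremalGraph₂) ∧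
    IsEmpty (heawoodGraph ≃g extremalGraph₃) ∧
    IsEmpty (extremalGraph₂ ≃g extremalGraph₃) ∧
    ∀ (V : Type*) [Finite V] (G : SimpleGraph V), IsPerfectExtremal 1 4 8 15 G →
      Nonempty (G ≃g heawoodGraph) ∨ Nonempty (G ≃g extremalGraph₂) ∨
        Nonempty (G ≃g extremalGraph₃) := by

  refine ⟨isPerfectDefectiveRamsey,
    isPerfectExtremal_of_fin (isPerfectGraph_of_colorable_two heawoodGraph_colorable)
      heawoodGraph_not_hasDenseSet heawoodGraph_not_hasSparseSet,
    isPerfectExtremal_of_fin extremalGraph₂_isPerfectGraph extremalGraph₂_not_hasDenseSet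
      extremalGraph₂_not_hasSparseSet,
    isPerfectExtremal_of_fin extremalGraph₃_isPerfectGraph extremalGraph₃_not_hasDenseSet
      extremalGraph₃_not_hasSparseSet, ⟨fun f => ?_⟩, ⟨fun f => ?_⟩, ⟨fun f => ?_⟩,
    fun V _ G h => nonempty_iso_of_isPerfectExtremal h⟩
  · have := card_adj_eq heawoodGraph_adj extremalGraph₂_adj f
    rw [card_adj_heawood, card_adj_extremal₂] at this
    omega
  · have := card_adj_eq heawoodGraph_adj extremalGraph₃_adj f
    rw [card_adj_heawood, card_adj_extremal₃] at this
    omega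
  · have := card_adj_eq extremalGraph₂_adj extremalGraph₃_adj f
    rw [card_adj_extremal₂, card_adj_extremal₃] at this
    omega
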